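/- Let $\hat{\mathbb C}=\mathbb C\cup\{\infty\}$ be the Riemann sphere and let $R=P/Q:\hat{\mathbb C}\to\hat{\mathbb C}$ be a rational map, where $P,Q\in\mathbb C[z]$ are coprime, of degree $d=\max(\deg P,\deg Q)\ge 2$. The Fatou set $F(R)$ is the set of all points that have an open neighbourhood $U$ on which the iterates $\{R^n|_U\}$ form a normal family, i.e. every sequence of iterates has a subsequence that converges uniformly on compact subsets of $U$ in the chordal metric; the Julia set is $J(R)=\hat{\mathbb C}\setminus F(R)$. Let $F_0$ be a connected component of $F(R)$ that is completely invariant, i.e. $R(F_0)=F_0=R^{-1}(F_0)$. Then: 1. $\partial F_0=J(R)$; 2. $F_0$ is either simply connected or infinitely connected, where infinitely connected means that $\hat{\mathbb C}\setminus F_0$ has infinitely many connected components; 3. every connected component of $F(R)$ other than $F_0$ is simply connected; 4. $F_0$ is simply connected if and only if $J(R)$ is connected. -/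

import Mathlib

noncomputable section

namespace RationalDynamics

open scoped OnePoint

/-- The degree of a rational function `R = P / Q` in lowest terms: `max (deg P) (deg Q)`. -/
def ratDegree (R : RatFunc ℂ) : ℕ :=
  max R.num.natDegree R.denom.natDegree

open Classical in
/-- The self-map of the Riemann sphere `ℂ ∪ {∞}` given by a rational function `R = P / Q` in lowest
terms. Finite poles go to `∞`, and the value at `∞` is the limit of `P z / Q z` as `z → ∞`. -/
def ratMap (R : RatFunc ℂ) : OnePoint ℂ → OnePoint ℂ
  | ∞ => if R.denom.natDegree < R.num.natDegree then ∞
      else ((R.num.coeff R.denom.natDegree / R.denom.leadingCoeff : ℂ) : OnePoint ℂ)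
  | (z : ℂ) => if R.denom.eval z = 0 then ∞
      else ((R.num.eval z / R.denom.eval z : ℂ) : OnePoint ℂ)

/-- The chordal metric on the Riemann sphere. -/
def chordalDist : OnePoint ℂ → OnePoint ℂ → ℝ
  | ∞, ∞ => 0
  | ∞, (w : ℂ) => 2 / Real.sqrt (1 + ‖w‖ ^ 2)
  | (z : ℂ), ∞ => 2 / Real.sqrt (1 + ‖z‖ ^ 2)
  | (z : ℂ), (w : ℂ) => 2 * ‖z - w‖ / (Real.sqrt (1 + ‖z‖ ^ 2) * Real.sqrt (1 + ‖w‖ ^ 2))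

/-- The sequence `f` converges to `g` uniformly on each compact subset of `U`, with respect to the
chordal metric. -/
def ConvergesOnCompacts (f : ℕ → OnePoint ℂ → OnePoint ℂ) (g : OnePoint ℂ → OnePoint ℂ)
    (U : Set (OnePoint ℂ)) : Prop :=
  ∀ K : Set (OnePoint ℂ), IsCompact K → K ⊆ U → ∀ ε : ℝ, 0 < ε →
    ∃ N : ℕ, ∀ n : ℕ, N ≤ n → ∀ z ∈ K, chordalDist (f n z) (g z) < ε

/-- A family of sphere-valued maps is normal on `U` if every sequence of its members has a
subsequence that converges uniformly on the compact subsets of `U`. -/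
def IsNormalFamilyOn {ι : Type*} (f : ι → OnePoint ℂ → OnePoint ℂ) (U : Set (OnePoint ℂ)) : Prop :=
  ∀ s : ℕ → ι, ∃ φ : ℕ → ℕ, StrictMono φ ∧
    ∃ g : OnePoint ℂ → OnePoint ℂ, ConvergesOnCompacts (fun n => f (s (φ n))) g U

/-- The Fatou set: the points with an open neighbourhood on which the iterates are normal. -/
def fatouSet (R : RatFunc ℂ) : Set (OnePoint ℂ) :=
  {z | ∃ U : Set (OnePoint ℂ), IsOpen U ∧ z ∈ U ∧
    IsNormalFamilyOn (fun n : ℕ => (ratMap R)^[n]) U}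

/-- The Julia set is the complement of the Fatou set. -/
def juliaSet (R : RatFunc ℂ) : Set (OnePoint ℂ) :=
  (fatouSet R)ᶜ

/-- `C` is a connected component of the subset `S`. -/
def IsComponentOf {X : Type*} [TopologicalSpace X] (C S : Set X) : Prop :=
  ∃ x ∈ S, C = connectedComponentIn S x

/-- `E` is completely invariant under `g`: `g(E) = E = g⁻¹(E)`. -/
def IsCompletelyInvariant {X : Type*} (g : X → X) (E : Set X) : Prop :=
  g '' E = E ∧ g ⁻¹' E = E

/-- `D` is infinitely connected: its complement has infinitely many connected components. -/
def IsInfinitelyConnected {X : Type*} [TopologicalSpace X] (D : Set X) : Prop :=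
  {C : Set X | IsComponentOf C Dᶜ}.Infinite

end RationalDynamics

end

/-! ### The Riemann sphere: chordal metric and homogeneous coordinates -/

noncomputable section

namespace RationalDynamics

open scoped OnePoint Topology
open Set Filter Topology

/-! If all iterates map a neighbourhood off a fixed open set, a Möbius change makes them bounded
holomorphic maps, and the Schwarz lemma gives equicontinuity (`equicontinuousAt_of_notMem_nhds`).
Complete invariance provides this outside `closure F₀`, with `F₀` as omitted set, so the Julia set
`J` is contained in `closure F₀` and `∂F₀ = J`.

The remaining claims become questions of connectedness once simple connectivity is traded for
connectedness of the complement. As `d ≥ 2`, `J` is nonempty, so the closure of every Fatou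
component meets it, and a connected set containing `J` stays connected when Fatou components are
added. Starting from `closure F₀` this yields the complement of any other component; starting from a
connected `J` it yields `F₀ᶜ`. Conversely, if `F₀` is simply connected, then `J = closure F₀ ∩ F₀ᶜ`
is connected by unicoherence of the sphere.

If `F₀ᶜ` has finitely many components, `R` permutes them and some `R^m` preserves each. Suppose
there are at least two. If one of them, `C`, has two points, then `Cᶜ` is a simply connected domain
invariant under `R^m`, and a square-root branch makes the iterates bounded, hence normal
(`equicontinuousAt_of_mapsTo`); but `Cᶜ` contains another component, which meets `J`. If all are
points, they are totally ramified, so `R` does not expand distances near them; nearby orbits then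
avoid a neighbourhood of a point of `F₀`, and `F₀ᶜ` would lie in the Fatou set
(`mem_fatouSet_of_finite`).

The trade rests on two theorems. In `isSimplyConnected_of_isPreconnected_compl_image` loops become
grid walks, contracted by pushing in the topmost corner; a winding number shows that the square
swept lies in the domain. In `IsSimplyConnected.isPreconnected_compl` a logarithm of `z - a` is cut
off to contradict the winding of `z - a` around a large circle. -/

/-- Inverse stereographic projection. -/
def stereo : OnePoint ℂ → WithLp 2 (ℂ × ℝ)
  | ∞ => WithLp.toLp 2 (0, 1)
  | (z : ℂ) => WithLp.toLp 2 (((2 / (1 + ‖z‖ ^ 2) : ℝ) : ℂ) * z, 1 - 2 / (1 + ‖z‖ ^ 2))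

/-- This realises the chordal distance as a Euclidean chord, so the metric axioms are inherited. -/
lemma dist_stereo (x y : OnePoint ℂ) : dist (stereo x) (stereo y) = chordalDist x y := by
  have key : ∀ z : ℂ, ‖z‖ ^ 2 = z.re ^ 2 + z.im ^ 2 := fun z => by
    rw [Complex.sq_norm, Complex.normSq_apply]; ring
  -- The left side is the distance from `stereo z` to the north pole.
  have aux : ∀ z : ℂ, √((‖((2 / (1 + ‖z‖ ^ 2) : ℝ) : ℂ) * z‖) ^ 2 + (2 / (1 + ‖z‖ ^ 2)) ^ 2) =
      2 / √(1 + ‖z‖ ^ 2) := by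
    intro z
    have h : (0 : ℝ) < 1 + ‖z‖ ^ 2 := by positivity
    rw [Real.sqrt_eq_iff_mul_self_eq_of_pos (by positivity), norm_mul, Complex.norm_real,
      Real.norm_of_nonneg (by positivity), ← sq, div_pow, Real.sq_sqrt h.le]
    field_simp
    ring
  induction x using OnePoint.rec with
  | infty =>
    induction y using OnePoint.rec with
    | infty => simp [chordalDist]
    | coe w =>
      rw [dist_comm]
      simp only [stereo, chordalDist, WithLp.prod_dist_eq_of_L2]
      rw [← aux w]
      simp only [WithLp.toLp_fst, WithLp.toLp_snd, dist_zero_right, Real.dist_eq,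
        sub_sub_cancel_left, abs_neg, sq_abs]
  | coe z =>
    induction y using OnePoint.rec with
    | infty =>
      simp only [stereo, chordalDist, WithLp.prod_dist_eq_of_L2]
      rw [← aux z]
      simp only [WithLp.toLp_fst, WithLp.toLp_snd, dist_zero_right, Real.dist_eq,
        sub_sub_cancel_left, abs_neg, sq_abs]
    | coe w =>
      simp only [stereo, chordalDist, WithLp.prod_dist_eq_of_L2]
      have hz : (0 : ℝ) < 1 + ‖z‖ ^ 2 := by positivity
      have hw : (0 : ℝ) < 1 + ‖w‖ ^ 2 := by positivity
      rw [Real.sqrt_eq_iff_mul_self_eq (by positivity) (by positivity), ← sq, div_pow, mul_pow,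
        mul_pow, Real.sq_sqrt hz.le, Real.sq_sqrt hw.le, dist_eq_norm, Real.dist_eq, sq_abs, key,
        key (z - w)]
      simp only [WithLp.toLp_fst, WithLp.toLp_snd, Complex.sub_re, Complex.sub_im,
        Complex.re_ofReal_mul, Complex.im_ofReal_mul]
      rw [key z, key w] at *
      field_simp
      ring

lemma stereo_injective : Function.Injective stereo := by
  intro x y h
  have h2 : chordalDist x y = 0 := by rw [← dist_stereo, h, dist_self]
  induction x using OnePoint.rec with
  | infty =>
    induction y using OnePoint.rec with
    | infty => rfl
    | coe w =>
      have : (0 : ℝ) < 1 + ‖w‖ ^ 2 := by positivity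
      simp only [chordalDist] at h2
      have : 0 < 2 / √(1 + ‖w‖ ^ 2) := by positivity
      linarith
  | coe z =>
    induction y using OnePoint.rec with
    | infty =>
      have : (0 : ℝ) < 1 + ‖z‖ ^ 2 := by positivity
      simp only [chordalDist] at h2
      have : 0 < 2 / √(1 + ‖z‖ ^ 2) := by positivity
      linarith
    | coe w =>
      have hz : (0 : ℝ) < √(1 + ‖z‖ ^ 2) := by positivity
      have hw : (0 : ℝ) < √(1 + ‖w‖ ^ 2) := by positivity
      simp only [chordalDist, div_eq_zero_iff, mul_eq_zero, hz.ne', hw.ne', or_false,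
        OfNat.ofNat_ne_zero, false_or, norm_eq_zero, sub_eq_zero] at h2
      rw [h2]

lemma continuous_stereo : Continuous stereo := by
  rw [continuous_iff_continuousAt]
  intro x
  induction x using OnePoint.rec with
  | infty =>
    rw [ContinuousAt, tendsto_iff_dist_tendsto_zero]
    simp_rw [dist_stereo]
    rw [OnePoint.tendsto_nhds_infty']
    refine ⟨?_, ?_⟩
    · rw [tendsto_pure_left]
      intro s hs
      have := mem_of_mem_nhds hs
      simpa [chordalDist] using this
    · rw [coclosedCompact_eq_cocompact]
      have h1 : Tendsto (fun z : ℂ => √(1 + ‖z‖ ^ 2)) (cocompact ℂ) atTop := by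
        refine Real.tendsto_sqrt_atTop.comp (tendsto_atTop_add_const_left _ _ ?_)
        exact (tendsto_pow_atTop two_ne_zero).comp (tendsto_norm_cocompact_atTop)
      exact h1.const_div_atTop 2
  | coe z =>
    rw [OnePoint.continuousAt_coe]
    have : ∀ z : ℂ, (1 + ‖z‖ ^ 2 : ℝ) ≠ 0 := fun z => by positivity
    have : Continuous fun z : ℂ => stereo (z : OnePoint ℂ) := by
      simp only [stereo]
      refine (WithLp.prod_continuous_toLp 2 ℂ ℝ).comp ?_
      fun_prop (disch := assumption)
    exact this.continuousAt

/-- By compactness `stereo` is an embedding, so the pulled-back uniformity induces the one-point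
topology already present. The distance is `chordalDist` by definition. -/
instance : MetricSpace (OnePoint ℂ) where
  dist := chordalDist
  toUniformSpace := (((continuous_stereo.isClosedEmbedding
    stereo_injective).isEmbedding).comapMetricSpace stereo).toUniformSpace
  uniformity_dist := by
    let _ := (((continuous_stereo.isClosedEmbedding
      stereo_injective).isEmbedding).comapMetricSpace stereo)
    have h := Metric.uniformity_eq_comap_nhds_zero (α := OnePoint ℂ)
    have h2 : ∀ x y : OnePoint ℂ, chordalDist x y = dist x y := fun x y => (dist_stereo x y).symm
    simp_rw [h2]
    exact PseudoMetricSpace.uniformity_dist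
  dist_self x := by rw [← dist_stereo, dist_self]
  dist_comm x y := by simp_rw [← dist_stereo]; exact dist_comm _ _
  dist_triangle x y z := by simp_rw [← dist_stereo]; exact dist_triangle _ _ _
  eq_of_dist_eq_zero := by
    intro x y h
    rw [← dist_stereo] at h
    exact stereo_injective (dist_eq_zero.1 h)

lemma chordalDist_eq_dist (x y : OnePoint ℂ) : chordalDist x y = dist x y := rfl

/-- The point of the sphere with given homogeneous coordinates. -/
def proj (x : ℂ × ℂ) : OnePoint ℂ :=
  open Classical in if x.2 = 0 then ∞ else ((x.1 / x.2 : ℂ) : OnePoint ℂ)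

lemma proj_one (z : ℂ) : proj (z, 1) = z := by simp [proj]

lemma proj_of_ne {x : ℂ × ℂ} (h : x.2 ≠ 0) : proj x = ((x.1 / x.2 : ℂ) : OnePoint ℂ) := by
  simp [proj, h]

lemma proj_smul {c : ℂ} (hc : c ≠ 0) (x : ℂ × ℂ) : proj (c • x) = proj x := by
  by_cases h : x.2 = 0
  · simp [proj, h]
  · simp [proj, h, hc, mul_div_mul_left]

/-- A choice of homogeneous coordinates. -/
def coords : OnePoint ℂ → ℂ × ℂ
  | ∞ => (1, 0)
  | (z : ℂ) => (z, 1)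

lemma coords_coe (z : ℂ) : coords z = (z, 1) := rfl

lemma coords_infty : coords ∞ = (1, 0) := rfl

lemma coords_ne_zero (s : OnePoint ℂ) : coords s ≠ 0 := by
  induction s using OnePoint.rec <;> simp [coords]

lemma proj_coords (s : OnePoint ℂ) : proj (coords s) = s := by
  induction s using OnePoint.rec <;> simp [coords, proj]

lemma proj_eq_iff {x y : ℂ × ℂ} (hx : x ≠ 0) (hy : y ≠ 0) :
    proj x = proj y ↔ x.1 * y.2 = x.2 * y.1 := by
  by_cases h : x.2 = 0 <;> by_cases h' : y.2 = 0
  · simp [proj, h, h']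
  · have : x.1 ≠ 0 := fun h0 => hx (Prod.ext h0 h)
    simp [proj, h, h', this]
  · have : y.1 ≠ 0 := fun h0 => hy (Prod.ext h0 h')
    simp [proj, h, h', this]
  · simp only [proj, h, h', if_false, OnePoint.coe_eq_coe]
    rw [div_eq_div_iff h h', mul_comm x.2]

lemma exists_smul_eq_of_proj_eq {x y : ℂ × ℂ} (hx : x ≠ 0) (hy : y ≠ 0) (h : proj x = proj y) :
    ∃ c : ℂ, c ≠ 0 ∧ y = c • x := by
  rw [proj_eq_iff hx hy] at h
  by_cases h1 : x.2 = 0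
  · have h0 : x.1 ≠ 0 := fun h0 => hx (Prod.ext h0 h1)
    have h3 : y.2 = 0 := by simpa [h1, h0] using h
    have h4 : y.1 ≠ 0 := fun h0 => hy (Prod.ext h0 h3)
    exact ⟨y.1 / x.1, div_ne_zero h4 h0, by ext <;> simp [h1, h3, h0]⟩
  · have h2 : y.2 ≠ 0 := by
      intro h2
      have : y.1 ≠ 0 := fun h0 => hy (Prod.ext h0 h2)
      simp [h2, h1, this] at h
    refine ⟨y.2 / x.2, div_ne_zero h2 h1, ?_⟩
    ext
    · simp; field_simp; linear_combination -h
    · simp; field_simp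

/-- The Hermitian norm on `ℂ × ℂ`. -/
def hnorm (x : ℂ × ℂ) : ℝ := √(‖x.1‖ ^ 2 + ‖x.2‖ ^ 2)

lemma hnorm_pos {x : ℂ × ℂ} (hx : x ≠ 0) : 0 < hnorm x := by
  apply Real.sqrt_pos.2
  by_cases h : x.1 = 0
  · have : x.2 ≠ 0 := fun h0 => hx (Prod.ext h h0)
    positivity
  · positivity

lemma continuous_hnorm : Continuous hnorm := by
  unfold hnorm; fun_prop

/-- The homogeneous formula treats `∞` like any other point; it gives continuity of `proj` and,
later, the estimate at ramified points. -/
lemma dist_proj {x y : ℂ × ℂ} (hx : x ≠ 0) (hy : y ≠ 0) :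
    dist (proj x) (proj y) = 2 * ‖x.1 * y.2 - x.2 * y.1‖ / (hnorm x * hnorm y) := by
  have aux : ∀ x : ℂ × ℂ, x.2 ≠ 0 → √(1 + ‖x.1 / x.2‖ ^ 2) = hnorm x / ‖x.2‖ := by
    intro x h
    have : 0 < ‖x.2‖ := norm_pos_iff.2 h
    rw [hnorm, Real.sqrt_eq_iff_mul_self_eq (by positivity) (by positivity), ← sq, div_pow,
      Real.sq_sqrt (by positivity), norm_div]
    field_simp
    ring
  have aux' : ∀ x : ℂ × ℂ, x.2 = 0 → hnorm x = ‖x.1‖ := by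
    intro x h
    simp [hnorm, h]
  have hnx := hnorm_pos hx
  have hny := hnorm_pos hy
  rw [← chordalDist_eq_dist]
  by_cases h : x.2 = 0 <;> by_cases h' : y.2 = 0
  · simp [proj, h, h', chordalDist]
  · have h0 : x.1 ≠ 0 := fun h0 => hx (Prod.ext h0 h)
    have h1 : ‖x.1‖ ≠ 0 := norm_ne_zero_iff.2 h0
    simp only [proj, h, h', chordalDist, if_true, if_false, aux y h', aux' x h]
    have : ‖y.2‖ ≠ 0 := norm_ne_zero_iff.2 h'
    simp only [zero_mul, sub_zero, norm_mul]
    field_simp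
  · have h0 : y.1 ≠ 0 := fun h0 => hy (Prod.ext h0 h')
    have h1 : ‖y.1‖ ≠ 0 := norm_ne_zero_iff.2 h0
    simp only [proj, h, h', chordalDist, if_true, if_false, aux x h, aux' y h']
    have : ‖x.2‖ ≠ 0 := norm_ne_zero_iff.2 h
    simp only [mul_zero, zero_sub, norm_neg, norm_mul]
    field_simp
  · simp only [proj, h, h', chordalDist, if_false, aux x h, aux y h']
    have h1 : ‖x.2‖ ≠ 0 := norm_ne_zero_iff.2 h
    have h2 : ‖y.2‖ ≠ 0 := norm_ne_zero_iff.2 h'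
    rw [div_sub_div _ _ h h', norm_div, norm_mul]
    field_simp

lemma continuousAt_proj {x : ℂ × ℂ} (hx : x ≠ 0) : ContinuousAt proj x := by
  rw [ContinuousAt, tendsto_iff_dist_tendsto_zero]
  have h1 : ∀ᶠ y in 𝓝 x, y ≠ 0 := isOpen_ne.mem_nhds hx
  have h2 : ContinuousAt (fun y : ℂ × ℂ => 2 * ‖y.1 * x.2 - y.2 * x.1‖ / (hnorm y * hnorm x)) x := by
    have := hnorm_pos hx
    have hc := continuous_hnorm
    apply ContinuousAt.div
    · fun_prop
    · fun_prop
    · positivity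
  have h3 := h2.tendsto
  rw [show x.1 * x.2 - x.2 * x.1 = 0 by ring, norm_zero, mul_zero, zero_div] at h3
  refine h3.congr' ?_
  filter_upwards [h1] with y hy
  rw [dist_proj hy hx]

lemma continuousOn_proj : ContinuousOn proj {0}ᶜ := fun _ hx =>
  (continuousAt_proj hx).continuousWithinAt

/-- `proj` on nonzero vectors. -/
def projNZ (x : {x : ℂ × ℂ // x ≠ 0}) : OnePoint ℂ := proj x

lemma continuous_projNZ : Continuous projNZ :=
  continuous_iff_continuousAt.2 fun x => (continuousAt_proj x.2).comp continuousAt_subtype_val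

/-- Already the restriction to the compact unit sphere is onto, and it is closed because the target
is Hausdorff. Continuity of maps with a lift and local path connectedness of the sphere follow from
this. -/
lemma isQuotientMap_projNZ : IsQuotientMap projNZ := by
  let ι : Metric.sphere (0 : ℂ × ℂ) 1 → {x : ℂ × ℂ // x ≠ 0} :=
    fun x => ⟨x, ne_zero_of_mem_unit_sphere x⟩
  have hι : Continuous ι := by fun_prop
  have hc : Continuous (projNZ ∘ ι) := continuous_projNZ.comp hι
  have hs : Function.Surjective (projNZ ∘ ι) := by
    intro s
    have h0 := norm_pos_iff.2 (coords_ne_zero s)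
    refine ⟨⟨((‖coords s‖⁻¹ : ℝ) : ℂ) • coords s, ?_⟩, ?_⟩
    · rw [mem_sphere_zero_iff_norm, norm_smul, Complex.norm_real, norm_inv, norm_norm,
        inv_mul_cancel₀ h0.ne']
    · simp only [Function.comp, projNZ, ι]
      rw [proj_smul, proj_coords]
      exact_mod_cast (inv_pos.2 h0).ne'
  exact (hc.isClosedMap.isQuotientMap hc hs).of_comp hι continuous_projNZ

instance : LocallyPathConnectedSpace (OnePoint ℂ) := by
  have : LocallyPathConnectedSpace {x : ℂ × ℂ // x ≠ 0} :=
    (isOpen_ne (x := (0 : ℂ × ℂ))).locallyPathConnectedSpace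
  exact isQuotientMap_projNZ.locallyPathConnectedSpace

/-- `Φ` is a holomorphic lift of `f` to homogeneous coordinates. -/
structure HasLift (f : OnePoint ℂ → OnePoint ℂ) (Φ : ℂ × ℂ → ℂ × ℂ) : Prop where
  differentiable : Differentiable ℂ Φ
  ne_zero : ∀ x, x ≠ 0 → Φ x ≠ 0
  proj_eq : ∀ x, x ≠ 0 → proj (Φ x) = f (proj x)

namespace HasLift

lemma id : HasLift id id := ⟨differentiable_id, fun _ h => h, fun _ _ => rfl⟩

lemma comp {f g : OnePoint ℂ → OnePoint ℂ} {Φ Ψ : ℂ × ℂ → ℂ × ℂ} (hf : HasLift f Φ)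
    (hg : HasLift g Ψ) : HasLift (f ∘ g) (Φ ∘ Ψ) :=
  ⟨hf.1.comp hg.1, fun x hx => hf.2 _ (hg.2 x hx), fun x hx => by
    simp [hf.3 _ (hg.2 x hx), hg.3 x hx]⟩

lemma iterate {f : OnePoint ℂ → OnePoint ℂ} {Φ : ℂ × ℂ → ℂ × ℂ} (hf : HasLift f Φ) (n : ℕ) :
    HasLift f^[n] Φ^[n] := by
  induction n with
  | zero => exact HasLift.id
  | succ n ih =>
    rw [Function.iterate_succ, Function.iterate_succ]
    exact ih.comp hf

lemma continuous {f : OnePoint ℂ → OnePoint ℂ} {Φ : ℂ × ℂ → ℂ × ℂ} (hf : HasLift f Φ) :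
    Continuous f := by
  rw [isQuotientMap_projNZ.continuous_iff]
  have : f ∘ projNZ = projNZ ∘ fun x : {x : ℂ × ℂ // x ≠ 0} => ⟨Φ x.1, hf.2 x.1 x.2⟩ := by
    ext x
    exact (hf.3 x x.2).symm
  rw [this]
  exact continuous_projNZ.comp ((hf.1.continuous.comp continuous_subtype_val).subtype_mk _)

end HasLift

end RationalDynamics

end

/-! ### Grid walks in a plane set and their winding numbers -/

noncomputable section

namespace RationalDynamics

open Set Filter Topology
open scoped unitInterval

/-- Two paths inside a convex subset of `Ω` with the same endpoints are homotopic in `Ω`. -/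
lemma mk_eq_mk_of_convex {Ω C : Set ℂ} (hC : Convex ℝ C) (hCΩ : C ⊆ Ω) {x y : Ω} (p q : Path x y)
    (hp : ∀ t, (p t : ℂ) ∈ C) (hq : ∀ t, (q t : ℂ) ∈ C) :
    Path.Homotopic.Quotient.mk p = Path.Homotopic.Quotient.mk q := by
  have key : ∀ s t : I, (1 - (s : ℝ)) • (p t : ℂ) + (s : ℝ) • (q t : ℂ) ∈ C := fun s t =>
    hC (hp t) (hq t) (by linarith [s.2.2]) s.2.1 (by ring)
  refine (Path.Homotopic.Quotient.eq).2 ⟨⟨⟨⟨fun z => ⟨_, hCΩ (key z.1 z.2)⟩, ?_⟩, ?_, ?_⟩, ?_⟩⟩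
  · fun_prop
  · intro t; ext; simp
  · intro t; ext; simp
  · intro s t ht
    have h2 : ∀ z : Ω, (1 - (s : ℝ)) • (z : ℂ) + (s : ℝ) • (z : ℂ) = z := by
      intro z
      rw [← add_smul]; simp
    rcases ht with rfl | rfl
    · ext; simpa using h2 x
    · ext; simpa using h2 y

/-- The straight path in `Ω` along a segment. -/
def linPath {Ω : Set ℂ} (x y : Ω) (h : segment ℝ (x : ℂ) y ⊆ Ω) : Path x y where
  toFun t := ⟨Path.segment (x : ℂ) y t, h (by
    rw [← Path.range_segment]; exact mem_range_self t)⟩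
  continuous_toFun := by fun_prop
  source' := by ext; simp
  target' := by ext; simp

lemma linPath_mem {Ω C : Set ℂ} (hC : Convex ℝ C) {x y : Ω} (h : segment ℝ (x : ℂ) y ⊆ Ω)
    (hx : (x : ℂ) ∈ C) (hy : (y : ℂ) ∈ C) (t : I) : (linPath x y h t : ℂ) ∈ C :=
  hC.segment_subset hx hy (by
    change Path.segment (x : ℂ) y t ∈ _
    rw [← Path.range_segment]; exact mem_range_self t)

/-- The class of the straight path between two points of a convex subset of `Ω`. -/
def linClass {Ω : Set ℂ} (x y : Ω) (h : segment ℝ (x : ℂ) y ⊆ Ω) : Path.Homotopic.Quotient x y :=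
  .mk (linPath x y h)

lemma trans_mem {Ω : Set ℂ} {x y z : Ω} {C : Set ℂ} {p : Path x y} {q : Path y z}
    (hp : ∀ t, (p t : ℂ) ∈ C) (hq : ∀ t, (q t : ℂ) ∈ C) (t : I) : ((p.trans q) t : ℂ) ∈ C := by
  have : (p.trans q) t ∈ range p ∪ range q := by
    rw [← Path.trans_range]; exact mem_range_self t
  rcases this with ⟨s, hs⟩ | ⟨s, hs⟩
  · rw [← hs]; exact hp s
  · rw [← hs]; exact hq s

lemma linClass_trans {Ω C : Set ℂ} (hC : Convex ℝ C) (hCΩ : C ⊆ Ω) {x y z : Ω}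
    (hx : (x : ℂ) ∈ C) (hy : (y : ℂ) ∈ C) (hz : (z : ℂ) ∈ C) (h1 : segment ℝ (x : ℂ) y ⊆ Ω)
    (h2 : segment ℝ (y : ℂ) z ⊆ Ω) (h3 : segment ℝ (x : ℂ) z ⊆ Ω) :
    (linClass x y h1).trans (linClass y z h2) = linClass x z h3 := by
  rw [linClass, linClass, linClass, ← Path.Homotopic.Quotient.mk_trans]
  exact mk_eq_mk_of_convex hC hCΩ _ _
    (trans_mem (linPath_mem hC h1 hx hy) (linPath_mem hC h2 hy hz)) (linPath_mem hC h3 hx hz)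

lemma linClass_self {Ω : Set ℂ} (x : Ω) (h : segment ℝ (x : ℂ) x ⊆ Ω) :
    linClass x x h = .refl x := by
  rw [← Path.Homotopic.Quotient.mk_refl]
  refine mk_eq_mk_of_convex (convex_singleton (x : ℂ)) (by simp) _ _
    (linPath_mem (convex_singleton _) h rfl rfl) (fun t => rfl)

/-- The point of the plane at a vertex of the square grid of mesh `δ`. -/
def gridPt (δ : ℝ) (u : ℤ × ℤ) : ℂ := ⟨δ * u.1, δ * u.2⟩

/-- The closed rectangle with two opposite corners at grid vertices. -/
def gridRect (δ : ℝ) (u v : ℤ × ℤ) : Set ℂ :=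
  uIcc (δ * u.1) (δ * v.1) ×ℂ uIcc (δ * u.2) (δ * v.2)

lemma convex_gridRect (δ : ℝ) (u v : ℤ × ℤ) : Convex ℝ (gridRect δ u v) :=
  ((convex_uIcc _ _).linear_preimage Complex.reLm).inter
    ((convex_uIcc _ _).linear_preimage Complex.imLm)

lemma left_mem_gridRect (δ : ℝ) (u v : ℤ × ℤ) : gridPt δ u ∈ gridRect δ u v :=
  ⟨left_mem_uIcc, left_mem_uIcc⟩

lemma right_mem_gridRect (δ : ℝ) (u v : ℤ × ℤ) : gridPt δ v ∈ gridRect δ u v :=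
  ⟨right_mem_uIcc, right_mem_uIcc⟩

/-- Unit steps of the grid. -/
def UnitStep (u v : ℤ × ℤ) : Prop :=
  (u.1 = v.1 ∧ (v.2 = u.2 + 1 ∨ u.2 = v.2 + 1)) ∨ (u.2 = v.2 ∧ (v.1 = u.1 + 1 ∨ u.1 = v.1 + 1))

/-- The grid edges that are contained in `Ω`. -/
def gridGraph (Ω : Set ℂ) (δ : ℝ) : SimpleGraph {u : ℤ × ℤ // gridPt δ u ∈ Ω} where
  Adj u v := UnitStep u v ∧ gridRect δ u v ⊆ Ω
  symm := ⟨by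
    rintro u v ⟨h1, h2⟩
    refine ⟨by unfold UnitStep at *; lia, ?_⟩
    rwa [gridRect, uIcc_comm, uIcc_comm (δ * v.1.2)]⟩
  loopless := ⟨by
    rintro u ⟨h1, -⟩
    unfold UnitStep at h1; lia⟩

variable {Ω : Set ℂ} {δ : ℝ}

/-- A grid vertex as a point of `Ω`. -/
def vtx (u : {u : ℤ × ℤ // gridPt δ u ∈ Ω}) : Ω := ⟨gridPt δ u, u.2⟩

lemma segment_subset_gridRect (u v : ℤ × ℤ) :
    segment ℝ (gridPt δ u) (gridPt δ v) ⊆ gridRect δ u v :=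
  (convex_gridRect δ u v).segment_subset (left_mem_gridRect δ u v) (right_mem_gridRect δ u v)

lemma segment_vtx_subset {u v : {u : ℤ × ℤ // gridPt δ u ∈ Ω}} (h : gridRect δ u v ⊆ Ω) :
    segment ℝ (vtx u : ℂ) (vtx v) ⊆ Ω :=
  (segment_subset_gridRect u.1 v.1).trans h

/-- The homotopy class of a grid walk. -/
def walkClass : ∀ {u v : {u : ℤ × ℤ // gridPt δ u ∈ Ω}}, (gridGraph Ω δ).Walk u v →
    Path.Homotopic.Quotient (vtx u) (vtx v)
  | _, _, .nil => .refl _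
  | _, _, .cons (v := v) h p =>
    (linClass (vtx _) (vtx v) (segment_vtx_subset h.2)).trans (walkClass p)

lemma walkClass_append {u v w : {u : ℤ × ℤ // gridPt δ u ∈ Ω}} (p : (gridGraph Ω δ).Walk u v)
    (q : (gridGraph Ω δ).Walk v w) :
    walkClass (p.append q) = (walkClass p).trans (walkClass q) := by
  induction p with
  | nil => simp [walkClass]
  | cons h p ih => simp only [SimpleGraph.Walk.cons_append, walkClass, ih,
      Path.Homotopic.Quotient.trans_assoc]

/-- The number of signed crossings of a walk with the horizontal ray issued to the right from
`(x, j + 1/2)`, with half-open conventions. -/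
def crossings (x : ℝ) (j : ℤ) : ∀ {u v : {u : ℤ × ℤ // gridPt δ u ∈ Ω}},
    (gridGraph Ω δ).Walk u v → ℤ
  | _, _, .nil => 0
  | u, _, .cons (v := v) _ p => (if x < u.1.1 then
      (if j < v.1.2 then 1 else 0) - (if j < u.1.2 then 1 else 0) else 0) + crossings x j p

lemma crossings_append (x : ℝ) (j : ℤ) {u v w : {u : ℤ × ℤ // gridPt δ u ∈ Ω}}
    (p : (gridGraph Ω δ).Walk u v) (q : (gridGraph Ω δ).Walk v w) :
    crossings x j (p.append q) = crossings x j p + crossings x j q := by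
  induction p with
  | nil => simp [crossings]
  | cons h p ih => simp only [SimpleGraph.Walk.cons_append, crossings, ih, add_assoc]

lemma mem_gridRect_iff {δ : ℝ} (hδ : 0 < δ) (u v : ℤ × ℤ) (e : ℂ) : e ∈ gridRect δ u v ↔
    e.re / δ ∈ uIcc (u.1 : ℝ) v.1 ∧ e.im / δ ∈ uIcc (u.2 : ℝ) v.2 := by
  have key : ∀ a b c : ℝ, a ∈ uIcc (δ * b) (δ * c) ↔ a / δ ∈ uIcc b c := by
    intro a b c
    rw [mem_uIcc, mem_uIcc, le_div_iff₀ hδ, le_div_iff₀ hδ, div_le_iff₀ hδ, div_le_iff₀ hδ]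
    simp only [mul_comm]
  rw [gridRect, Complex.mem_reProdIm, key, key]

/-- A counted edge is vertical and joins rows `j` and `j + 1`; in the column `e.re / δ` it would
contain `e`, which is outside `Ω`. The interval allowed for `x` contains no integer other than
possibly `e.re / δ`, so no counted edge changes sides. -/
lemma crossings_congr_right (hδ : 0 < δ) {e : ℂ} (he : e ∉ Ω) {j : ℤ} (h1 : j ≤ e.im / δ)
    (h2 : e.im / δ ≤ j + 1) {x : ℝ} (hx1 : ⌈e.re / δ⌉ - 1 < x) (hx2 : x < ⌊e.re / δ⌋ + 1)
    {u v : {u : ℤ × ℤ // gridPt δ u ∈ Ω}} (p : (gridGraph Ω δ).Walk u v) :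
    crossings x j p = crossings (e.re / δ) j p := by
  induction p with
  | nil => rfl
  | @cons u v w h p ih =>
    rw [crossings, crossings, ih]
    congr 1
    have hne : ¬ e ∈ gridRect δ u v := fun h' => he (h.2 h')
    rw [mem_gridRect_iff hδ] at hne
    rcases h.1 with ⟨h3, h4⟩ | ⟨h3, h4⟩
    · by_cases hj : (j < v.1.2 ↔ j < u.1.2)
      · simp [hj]
      · have hX : ((u.1.1 : ℤ) : ℝ) ≠ e.re / δ := by
          intro hX
          apply hne
          rw [← h3, hX, uIcc_self]
          refine ⟨rfl, ?_⟩
          rcases h4 with h4 | h4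
          · have : u.1.2 = j := by lia
            rw [h4, this, mem_uIcc]; left; push_cast; exact ⟨h1, h2⟩
          · have : v.1.2 = j := by lia
            rw [h4, this, mem_uIcc]; right; push_cast; exact ⟨h1, h2⟩
        have : x < u.1.1 ↔ e.re / δ < u.1.1 := by
          constructor
          · intro h5
            by_contra h6
            have h7 : (u.1.1 : ℝ) < e.re / δ := lt_of_le_of_ne (not_lt.1 h6) hX
            have h8 : u.1.1 < ⌈e.re / δ⌉ := Int.lt_ceil.2 h7
            have : (u.1.1 : ℝ) ≤ ⌈e.re / δ⌉ - 1 := by exact_mod_cast Int.le_sub_one_of_lt h8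
            linarith
          · intro h5
            have h8 : ⌊e.re / δ⌋ < u.1.1 := Int.floor_lt.2 h5
            have : (⌊e.re / δ⌋ + 1 : ℝ) ≤ u.1.1 := by exact_mod_cast h8
            linarith
        simp only [this]
    · rw [h3]; simp

/-- The effect of moving the ray across row `j` telescopes: a horizontal edge in that row cannot
contain `e`, so its ends lie on the same side of `e`. For a closed walk the difference vanishes. -/
lemma crossings_sub_one (hδ : 0 < δ) {e : ℂ} (he : e ∉ Ω) {j : ℤ} (h1 : e.im / δ = j)
    {u v : {u : ℤ × ℤ // gridPt δ u ∈ Ω}} (p : (gridGraph Ω δ).Walk u v) :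
    crossings (e.re / δ) j p - crossings (e.re / δ) (j - 1) p =
      (if e.re / δ < u.1.1 ∧ u.1.2 = j then 1 else 0) -
        (if e.re / δ < v.1.1 ∧ v.1.2 = j then 1 else 0) := by
  induction p with
  | nil => simp [crossings]
  | @cons u v w h p ih =>
    have hstep : ((if e.re / δ < u.1.1 then
      (if j < v.1.2 then 1 else 0) - (if j < u.1.2 then 1 else 0) else 0) -
      (if e.re / δ < u.1.1 then
      (if j - 1 < v.1.2 then 1 else 0) - (if j - 1 < u.1.2 then 1 else 0) else 0) : ℤ) =
        (if e.re / δ < u.1.1 ∧ u.1.2 = j then 1 else 0) -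
        (if e.re / δ < v.1.1 ∧ v.1.2 = j then 1 else 0) := by
      have hne : ¬ e ∈ gridRect δ u v := fun h' => he (h.2 h')
      rw [mem_gridRect_iff hδ, h1] at hne
      rcases h.1 with ⟨h3, h4⟩ | ⟨h3, h4⟩
      · rw [← h3]
        by_cases hx : e.re / δ < u.1.1
        · simp only [hx, if_true, true_and]
          split_ifs <;> lia
        · simp [hx]
      · rw [← h3]
        by_cases hj : u.1.2 = j
        · have : e.re / δ < u.1.1 ↔ e.re / δ < v.1.1 := by
            rw [← h3, hj, uIcc_self] at hne
            have hne' : e.re / δ ∉ uIcc (u.1.1 : ℝ) v.1.1 := fun h' => hne ⟨h', rfl⟩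
            rw [mem_uIcc] at hne'
            push Not at hne'
            constructor
            · intro h5
              by_contra h6
              exact absurd (hne'.2 (not_lt.1 h6)) (by linarith)
            · intro h5
              by_contra h6
              exact absurd (hne'.1 (not_lt.1 h6)) (by linarith)
          simp [this]
        · simp [hj]
    rw [crossings, crossings]
    linear_combination hstep + ih

/-- The winding number of a closed grid walk around a point, as a signed count of crossings. -/
def windingNum {u v : {u : ℤ × ℤ // gridPt δ u ∈ Ω}} (p : (gridGraph Ω δ).Walk u v) (e : ℂ) : ℤ :=
  crossings (e.re / δ) ⌊e.im / δ⌋ p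

lemma windingNum_eventually (hδ : 0 < δ) {e : ℂ} (he : e ∉ Ω)
    {u : {u : ℤ × ℤ // gridPt δ u ∈ Ω}} (p : (gridGraph Ω δ).Walk u u) :
    ∀ᶠ e' in 𝓝 e, windingNum p e' = windingNum p e := by
  have hre : Continuous fun e : ℂ => e.re / δ := by fun_prop
  have him : Continuous fun e : ℂ => e.im / δ := by fun_prop
  have c1 : (⌈e.re / δ⌉ - 1 : ℝ) < e.re / δ := by linarith [Int.ceil_lt_add_one (e.re / δ)]
  have c2 : e.re / δ < ⌊e.re / δ⌋ + 1 := Int.lt_floor_add_one _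
  have c3 : (⌈e.im / δ⌉ - 1 : ℝ) < e.im / δ := by linarith [Int.ceil_lt_add_one (e.im / δ)]
  have c4 : e.im / δ < ⌊e.im / δ⌋ + 1 := Int.lt_floor_add_one _
  filter_upwards [hre.continuousAt.eventually_const_lt c1, hre.continuousAt.eventually_lt_const c2,
    him.continuousAt.eventually_const_lt c3, him.continuousAt.eventually_lt_const c4]
    with e' d1 d2 d3 d4
  have f1 := Int.floor_le (e.im / δ)
  rw [windingNum, windingNum]
  by_cases hy : (⌊e.im / δ⌋ : ℝ) ≤ e'.im / δ
  · have : ⌊e'.im / δ⌋ = ⌊e.im / δ⌋ := Int.floor_eq_iff.2 ⟨hy, d4⟩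
    rw [this]
    exact crossings_congr_right hδ he f1 c4.le d1 d2 p
  -- The floor can drop only if `e` lies exactly on a grid row; closedness of the walk absorbs the
  -- jump.
  · push Not at hy
    have hlt : ⌈e.im / δ⌉ - 1 < ⌊e.im / δ⌋ := by
      have : ((⌈e.im / δ⌉ - 1 : ℤ) : ℝ) < (⌊e.im / δ⌋ : ℤ) := by push_cast; linarith
      exact_mod_cast this
    have hle := Int.floor_le_ceil (e.im / δ)
    have heq : ⌈e.im / δ⌉ = ⌊e.im / δ⌋ := by lia
    have hint : e.im / δ = ⌊e.im / δ⌋ := le_antisymm (by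
      conv_rhs => rw [← heq]
      exact Int.le_ceil _) f1
    have hfl : ⌊e'.im / δ⌋ = ⌊e.im / δ⌋ - 1 := by
      rw [Int.floor_eq_iff]
      rw [heq] at d3
      push_cast
      exact ⟨d3.le, by linarith⟩
    rw [hfl, crossings_congr_right hδ he (by push_cast; linarith) (by push_cast; linarith) d1 d2 p]
    have := crossings_sub_one hδ he hint p
    linarith

/-- Every step is counted, so the sum telescopes; it is zero for a closed walk. -/
lemma crossings_eq_zero_of_lt {x : ℝ} {j : ℤ} {u v : {u : ℤ × ℤ // gridPt δ u ∈ Ω}}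
    (p : (gridGraph Ω δ).Walk u v) (h : ∀ w ∈ p.support, x < w.1.1) :
    crossings x j p = (if j < v.1.2 then 1 else 0) - (if j < u.1.2 then 1 else 0) := by
  induction p with
  | nil => simp [crossings]
  | cons h' p ih =>
    simp only [SimpleGraph.Walk.support_cons, List.mem_cons, forall_eq_or_imp] at h
    rw [crossings, ih h.2, if_pos h.1]
    ring

lemma crossings_eq_zero_of_le {x : ℝ} {j : ℤ} {u v : {u : ℤ × ℤ // gridPt δ u ∈ Ω}}
    (p : (gridGraph Ω δ).Walk u v) (h : ∀ w ∈ p.support, (w.1.1 : ℝ) ≤ x) :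
    crossings x j p = 0 := by
  induction p with
  | nil => simp [crossings]
  | cons h' p ih =>
    simp only [SimpleGraph.Walk.support_cons, List.mem_cons, forall_eq_or_imp] at h
    rw [crossings, ih h.2, if_neg (not_lt.2 h.1)]
    ring

lemma crossings_eq_zero_of_snd {x : ℝ} {j : ℤ} {u v : {u : ℤ × ℤ // gridPt δ u ∈ Ω}}
    (p : (gridGraph Ω δ).Walk u v) (h : (∀ w ∈ p.support, w.1.2 ≤ j) ∨ ∀ w ∈ p.support, j < w.1.2) :
    crossings x j p = 0 := by
  induction p with
  | nil => simp [crossings]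
  | @cons u v w h' p ih =>
    have hv : v ∈ (SimpleGraph.Walk.cons h' p).support := by simp
    have hu : u ∈ (SimpleGraph.Walk.cons h' p).support := by simp
    have : crossings x j p = 0 := ih (h.imp (fun h w hw => h w (by simp [hw]))
      fun h w hw => h w (by simp [hw]))
    rw [crossings, this]
    rcases h with h | h
    · simp [not_lt.2 (h v hv), not_lt.2 (h u hu)]
    · simp [h v hv, h u hu]

lemma exists_bound_support {u v : {u : ℤ × ℤ // gridPt δ u ∈ Ω}} (p : (gridGraph Ω δ).Walk u v) :
    ∃ B : ℤ, 0 < B ∧ ∀ w ∈ p.support, |w.1.1| < B ∧ |w.1.2| < B := by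
  induction p with
  | @nil v => exact ⟨|v.1.1| + |v.1.2| + 1, by positivity, fun w hw => by
      rw [SimpleGraph.Walk.support_nil, List.mem_singleton] at hw
      subst hw
      have := abs_nonneg w.1.1
      have := abs_nonneg w.1.2
      constructor <;> lia⟩
  | @cons u v w h p ih =>
    obtain ⟨B, hB, h⟩ := ih
    refine ⟨B + |u.1.1| + |u.1.2|, by positivity, fun w hw => ?_⟩
    have h1 := abs_nonneg u.1.1
    have h2 := abs_nonneg u.1.2
    rw [SimpleGraph.Walk.support_cons, List.mem_cons] at hw
    rcases hw with rfl | hw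
    · constructor <;> lia
    · have := h w hw
      constructor <;> lia

lemma windingNum_eq_zero_of_large (hδ : 0 < δ) {u : {u : ℤ × ℤ // gridPt δ u ∈ Ω}}
    (p : (gridGraph Ω δ).Walk u u) : ∃ r : ℝ, ∀ e : ℂ, r < ‖e‖ → windingNum p e = 0 := by
  obtain ⟨B, hB, h⟩ := exists_bound_support p
  refine ⟨2 * ((B + 1) * δ), fun e he => ?_⟩
  have h0 : (B + 1) * δ < |e.re| ∨ (B + 1) * δ < |e.im| := by
    by_contra! h0
    have := Complex.norm_le_abs_re_add_abs_im e
    linarith [h0.1, h0.2]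
  rw [windingNum]
  rcases h0 with h0 | h0
  · rw [lt_abs] at h0
    rcases h0 with h0 | h0
    · rw [← lt_div_iff₀ hδ] at h0
      refine crossings_eq_zero_of_le p fun w hw => ?_
      have : (w.1.1 : ℝ) < B := by exact_mod_cast (abs_lt.1 (h w hw).1).2
      linarith
    · rw [← lt_div_iff₀ hδ, neg_div] at h0
      rw [crossings_eq_zero_of_lt p fun w hw => ?_, sub_self]
      have : (-B : ℝ) < w.1.1 := by exact_mod_cast (abs_lt.1 (h w hw).1).1
      linarith
  · refine crossings_eq_zero_of_snd p ?_
    rw [lt_abs] at h0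
    rcases h0 with h0 | h0
    · left
      intro w hw
      rw [← lt_div_iff₀ hδ] at h0
      have : B ≤ ⌊e.im / δ⌋ := Int.le_floor.2 (by linarith)
      have := (abs_lt.1 (h w hw).2).2
      lia
    · right
      intro w hw
      rw [← lt_div_iff₀ hδ, neg_div] at h0
      have : ⌊e.im / δ⌋ < -B := Int.floor_lt.2 (by push_cast; linarith)
      have := (abs_lt.1 (h w hw).2).1
      lia

/-- The winding number is a locally constant integer on the complement, which is connected and
contains `∞`. -/
lemma windingNum_eq_zero (hδ : 0 < δ) (hconn : IsPreconnected (((↑) : ℂ → OnePoint ℂ) '' Ω)ᶜ)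
    {u : {u : ℤ × ℤ // gridPt δ u ∈ Ω}} (p : (gridGraph Ω δ).Walk u u) {e : ℂ} (he : e ∉ Ω) :
    windingNum p e = 0 := by
  -- The value 0 at `∞` is forced, since far points have winding number 0.
  let F : OnePoint ℂ → ℤ := fun s => s.elim 0 (windingNum p)
  have hF : ContinuousOn F (((↑) : ℂ → OnePoint ℂ) '' Ω)ᶜ := by
    intro s hs
    apply ContinuousAt.continuousWithinAt
    induction s using OnePoint.rec with
    | infty =>
      rw [OnePoint.continuousAt_infty', coclosedCompact_eq_cocompact]
      obtain ⟨r, hr⟩ := windingNum_eq_zero_of_large hδ p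
      refine tendsto_nhds_of_eventually_eq ?_
      filter_upwards [tendsto_norm_cocompact_atTop.eventually_gt_atTop r] with z hz
      exact hr z hz
    | coe z =>
      rw [OnePoint.continuousAt_coe]
      refine tendsto_nhds_of_eventually_eq ?_
      have hz : z ∉ Ω := fun h => hs ⟨z, h, rfl⟩
      exact windingNum_eventually hδ hz p
  have := hconn.constant hF (x := (e : OnePoint ℂ)) (y := OnePoint.infty)
    (by rintro ⟨z, hz, h⟩; exact he (OnePoint.coe_injective h ▸ hz)) (by simp)
  exact this

end RationalDynamics

end

/-! ### Contraction of closed grid walks -/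

noncomputable section

namespace RationalDynamics

open Set Filter Topology
open scoped unitInterval

variable {Ω : Set ℂ} {δ : ℝ}

/-- At the top right corner of a closed walk, the unit square inside the corner lies in `Ω`. -/
lemma gridRect_subset_of_corner (hδ : 0 < δ)
    (hconn : IsPreconnected (((↑) : ℂ → OnePoint ℂ) '' Ω)ᶜ)
    {M a b : {u : ℤ × ℤ // gridPt δ u ∈ Ω}} (h1 : (gridGraph Ω δ).Adj M a)
    (p : (gridGraph Ω δ).Walk a b) (h2 : (gridGraph Ω δ).Adj b M) (hM : M ∉ p.support)
    (hmax : ∀ w ∈ p.support, w.1.2 < M.1.2 ∨ (w.1.2 = M.1.2 ∧ w.1.1 ≤ M.1.1)) (hab : a ≠ b) :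
    gridRect δ (M.1.1 - 1, M.1.2 - 1) M.1 ⊆ Ω ∧
      ((a.1 = (M.1.1 - 1, M.1.2) ∧ b.1 = (M.1.1, M.1.2 - 1)) ∨
        (b.1 = (M.1.1 - 1, M.1.2) ∧ a.1 = (M.1.1, M.1.2 - 1))) := by
  have ha := hmax a p.start_mem_support
  have hb := hmax b p.end_mem_support
  have hdir : (a.1 = (M.1.1 - 1, M.1.2) ∧ b.1 = (M.1.1, M.1.2 - 1)) ∨
        (b.1 = (M.1.1 - 1, M.1.2) ∧ a.1 = (M.1.1, M.1.2 - 1)) := by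
    have h3 := h1.1
    have h4 := h2.1
    have h5 : a.1 ≠ b.1 := fun h => hab (Subtype.ext h)
    rw [Ne, Prod.ext_iff] at h5
    simp only [Prod.ext_iff]
    unfold UnitStep at h3 h4
    lia
  refine ⟨fun e he => ?_, hdir⟩
  by_contra heΩ
  -- A point `e` of the square outside `Ω` has winding number 0, but its ray to the right meets only
  -- the edge below `M`, which gives ±1.
  have hN := windingNum_eq_zero hδ hconn (.cons h1 (p.append (.cons h2 .nil))) heΩ
  have hedge : ∀ c : ℤ × ℤ, (c = a.1 ∨ c = b.1) → e ∉ gridRect δ c M.1 := by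
    intro c hc he'
    rcases hc with rfl | rfl
    · exact heΩ (((gridGraph Ω δ).symm.symm _ _ h1).2 he')
    · exact heΩ (h2.2 he')
  have hl := hedge (M.1.1 - 1, M.1.2) (by rcases hdir with h | h <;> simp [h.1])
  have hd := hedge (M.1.1, M.1.2 - 1) (by rcases hdir with h | h <;> simp [h.2])
  rw [mem_gridRect_iff hδ] at hl hd he
  push_cast at he hl hd
  have he' := he
  rw [mem_uIcc, mem_uIcc] at he
  have hx1 : (M.1.1 : ℝ) - 1 ≤ e.re / δ := by rcases he.1 with h | h <;> linarith [h.1, h.2]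
  have hx2 : e.re / δ ≤ M.1.1 := by rcases he.1 with h | h <;> linarith [h.1, h.2]
  have hy1 : (M.1.2 : ℝ) - 1 ≤ e.im / δ := by rcases he.2 with h | h <;> linarith [h.1, h.2]
  have hy2 : e.im / δ ≤ M.1.2 := by rcases he.2 with h | h <;> linarith [h.1, h.2]
  have hx3 : e.re / δ < M.1.1 := by
    refine lt_of_le_of_ne hx2 fun h => hd ⟨by rw [h]; simp, he'.2⟩
  have hy3 : e.im / δ < M.1.2 := by
    refine lt_of_le_of_ne hy2 fun h => hl ⟨he'.1, by rw [h]; simp⟩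
  have hfl : ⌊e.im / δ⌋ = M.1.2 - 1 := Int.floor_eq_iff.2 ⟨by push_cast; exact hy1, by
    push_cast; linarith⟩
  -- A vertex of `p` to the right of `e` has column at least that of `M`; by maximality, and since
  -- `M` is not on `p`, it lies below the row of `M`. Hence no edge of `p` crosses.
  have hp : crossings (e.re / δ) (M.1.2 - 1) p = 0 := by
    clear hN hdir h1 h2 ha hb hab hedge
    induction p with
    | nil => rfl
    | @cons u v w h p ih =>
      have hu : u ∈ (SimpleGraph.Walk.cons h p).support := by simp
      have hv : v ∈ (SimpleGraph.Walk.cons h p).support := by simp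
      rw [crossings, ih (fun h' => hM (by simp [h'])) (fun w hw => hmax w (by simp [hw]))]
      have hu1 := hmax u hu
      have hv1 := hmax v hv
      have hu2 : u.1 ≠ M.1 := fun h' => hM (by rwa [← Subtype.ext h'])
      have hv2 : v.1 ≠ M.1 := fun h' => hM (by rwa [← Subtype.ext h'])
      rw [Ne, Prod.ext_iff] at hu2 hv2
      have hst := h.1
      unfold UnitStep at hst
      by_cases hx : e.re / δ < u.1.1
      · have : M.1.1 - 1 < u.1.1 := by
          have : ((M.1.1 - 1 : ℤ) : ℝ) < u.1.1 := by push_cast; linarith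
          exact_mod_cast this
        rw [if_pos hx]
        split_ifs <;> lia
      · simp [hx]
  rw [windingNum, hfl, crossings, crossings_append, hp, crossings, crossings] at hN
  rcases hdir with ⟨h3, h4⟩ | ⟨h3, h4⟩
  · simp [h3, h4, hx3] at hN
  · simp [h3, h4, hx3] at hN

/-- A measure of the complexity of a walk. -/
def walkWeight (m : ℤ) : ∀ {u v : {u : ℤ × ℤ // gridPt δ u ∈ Ω}}, (gridGraph Ω δ).Walk u v → ℕ
  | _, _, .nil => 0
  | u, _, .cons _ p => 1 + (u.1.1 - m).toNat + (u.1.2 - m).toNat + walkWeight m p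

lemma walkWeight_append (m : ℤ) {u v w : {u : ℤ × ℤ // gridPt δ u ∈ Ω}}
    (p : (gridGraph Ω δ).Walk u v) (q : (gridGraph Ω δ).Walk v w) :
    walkWeight m (p.append q) = walkWeight m p + walkWeight m q := by
  induction p with
  | nil => simp [walkWeight]
  | cons h p ih => simp only [SimpleGraph.Walk.cons_append, walkWeight, ih, add_assoc]

/-- Triviality of a loop class does not depend on the base point, so a closed walk may be started at
its extremal vertex. -/
lemma walkClass_eq_refl_of_rotate {u v : {u : ℤ × ℤ // gridPt δ u ∈ Ω}}
    (p : (gridGraph Ω δ).Walk u v) (q : (gridGraph Ω δ).Walk v u)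
    (h : walkClass (q.append p) = .refl _) : walkClass (p.append q) = .refl _ := by
  rw [walkClass_append] at h ⊢
  have h2 : walkClass p = (walkClass q).symm := by
    rw [← Path.Homotopic.Quotient.refl_trans (walkClass p),
      ← Path.Homotopic.Quotient.symm_trans (walkClass q), Path.Homotopic.Quotient.trans_assoc, h,
      Path.Homotopic.Quotient.trans_refl]
  rw [h2, Path.Homotopic.Quotient.symm_trans]

/-- Inside the convex set `C` both edges at `M` can be rerouted through `c`; the loop at `M` is then
the loop at `c` conjugated by a segment. -/
lemma walkClass_push {M a b c : {u : ℤ × ℤ // gridPt δ u ∈ Ω}} {C : Set ℂ} (hC : Convex ℝ C)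
    (hCΩ : C ⊆ Ω) (hM : gridPt δ M ∈ C) (ha : gridPt δ a ∈ C) (hb : gridPt δ b ∈ C)
    (hc : gridPt δ c ∈ C) (h1 : (gridGraph Ω δ).Adj M a) (p : (gridGraph Ω δ).Walk a b)
    (h2 : (gridGraph Ω δ).Adj b M) (h1' : (gridGraph Ω δ).Adj c a)
    (h2' : (gridGraph Ω δ).Adj b c)
    (h : walkClass (.cons h1' (p.append (.cons h2' .nil))) = .refl _) :
    walkClass (.cons h1 (p.append (.cons h2 .nil))) = .refl _ := by
  have hs : ∀ x y : {u : ℤ × ℤ // gridPt δ u ∈ Ω}, gridPt δ x ∈ C → gridPt δ y ∈ C →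
      segment ℝ (vtx x : ℂ) (vtx y) ⊆ Ω := fun x y hx hy => (hC.segment_subset hx hy).trans hCΩ
  simp only [walkClass, walkClass_append, Path.Homotopic.Quotient.trans_refl] at h ⊢
  rw [← linClass_trans hC hCΩ (x := vtx M) (y := vtx c) (z := vtx a) hM hc ha (hs _ _ hM hc)
    (hs _ _ hc ha), ← linClass_trans hC hCΩ (x := vtx b) (y := vtx c) (z := vtx M) hb hc hM
    (hs _ _ hb hc) (hs _ _ hc hM)]
  have h3 : ∀ {x y z w v t : Ω} (q1 : Path.Homotopic.Quotient x y)
      (q2 : Path.Homotopic.Quotient y z) (q3 : Path.Homotopic.Quotient z w)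
      (q4 : Path.Homotopic.Quotient w v) (q5 : Path.Homotopic.Quotient v t),
      (q1.trans q2).trans (q3.trans (q4.trans q5)) =
        (q1.trans (q2.trans (q3.trans q4))).trans q5 := by
    intros
    simp only [Path.Homotopic.Quotient.trans_assoc]
  rw [h3, h, Path.Homotopic.Quotient.trans_refl,
    linClass_trans hC hCΩ (x := vtx M) (y := vtx c) (z := vtx M) hM hc hM _ _ (hs _ _ hM hM),
    linClass_self]

/-- Strong induction on the weight. At a vertex `M` that is highest, and rightmost among the
highest, the walk is split, loses a spike, or has `M` replaced by the opposite corner of a unit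
square. The bound `m` keeps the truncated differences in the weight exact, so the last move lowers
it too. -/
lemma walkClass_eq_refl_aux (hδ : 0 < δ)
    (hconn : IsPreconnected (((↑) : ℂ → OnePoint ℂ) '' Ω)ᶜ) (m : ℤ) (n : ℕ) :
    ∀ {v : {u : ℤ × ℤ // gridPt δ u ∈ Ω}} (w : (gridGraph Ω δ).Walk v v), walkWeight m w = n →
      (∀ x ∈ w.support, m ≤ x.1.1 ∧ m ≤ x.1.2) → walkClass w = .refl _ := by
  induction n using Nat.strong_induction_on with
  | _ n ih =>
    intro v w hn hw
    obtain ⟨M, hM, hmax⟩ := w.support.toFinset.exists_max_image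
      (fun x => toLex (x.1.2, x.1.1)) ⟨v, by simp⟩
    rw [List.mem_toFinset] at hM
    simp only [List.mem_toFinset, Prod.Lex.toLex_le_toLex] at hmax
    rw [← w.take_spec hM]
    apply walkClass_eq_refl_of_rotate
    set q := (w.dropUntil M hM).append (w.takeUntil M hM) with hq
    have hqn : walkWeight m q = n := by
      rw [hq, walkWeight_append, add_comm, ← walkWeight_append, w.take_spec, hn]
    have hsub : ∀ x ∈ q.support, x ∈ w.support := by
      intro x hx
      rw [hq, SimpleGraph.Walk.mem_support_append_iff] at hx
      rcases hx with hx | hx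
      · exact w.support_dropUntil_subset_support _ hx
      · exact w.support_takeUntil_subset_support _ hx
    replace hmax : ∀ x ∈ q.support, x.1.2 < M.1.2 ∨ (x.1.2 = M.1.2 ∧ x.1.1 ≤ M.1.1) :=
      fun x hx => hmax x (hsub x hx)
    replace hw : ∀ x ∈ q.support, m ≤ x.1.1 ∧ m ≤ x.1.2 := fun x hx => hw x (hsub x hx)
    clear_value q
    cases q with
    | nil => rfl
    | @cons _ a _ h1 r =>
      obtain ⟨b, p, h2, hr⟩ : ∃ (b : _) (p : (gridGraph Ω δ).Walk a b)
          (h2 : (gridGraph Ω δ).Adj b M), r = p.append (.cons h2 .nil) := by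
        cases r with
        | nil => exact (h1.ne rfl).elim
        | cons h r =>
          obtain ⟨b, p, h2, hr⟩ := SimpleGraph.Walk.exists_cons_eq_concat h r
          exact ⟨b, p, h2, hr⟩
      subst hr
      have hw' : ∀ x ∈ p.support, m ≤ x.1.1 ∧ m ≤ x.1.2 := fun x hx => hw x (by
        simp [SimpleGraph.Walk.mem_support_append_iff, hx])
      have hwM := hw M (by simp)
      -- A second visit to `M` splits the walk into two shorter loops.
      by_cases hMp : M ∈ p.support
      · rw [← p.take_spec hMp] at hqn ⊢
        rw [← SimpleGraph.Walk.append_assoc, ← SimpleGraph.Walk.cons_append, walkWeight_append] at hqn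
        rw [← SimpleGraph.Walk.append_assoc, ← SimpleGraph.Walk.cons_append, walkClass_append,
          ih _ ?_ (.cons h1 (p.takeUntil M hMp)) rfl ?_,
          ih _ ?_ ((p.dropUntil M hMp).append (.cons h2 .nil)) rfl ?_,
          Path.Homotopic.Quotient.trans_refl]
        · rw [← hqn, walkWeight_append, walkWeight]; simp only [walkWeight]; lia
        · intro x hx
          rw [SimpleGraph.Walk.mem_support_append_iff] at hx
          simp only [SimpleGraph.Walk.support_cons, SimpleGraph.Walk.support_nil,
            List.mem_cons, List.not_mem_nil, or_false] at hx
          rcases hx with hx | rfl | rfl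
          · exact hw' x (p.support_dropUntil_subset_support _ hx)
          · exact hw' _ p.end_mem_support
          · exact hwM
        · rw [← hqn, walkWeight_append, walkWeight]; simp only [walkWeight]; lia
        · intro x hx
          simp only [SimpleGraph.Walk.support_cons, List.mem_cons] at hx
          rcases hx with rfl | hx
          · exact hwM
          · exact hw' x (p.support_takeUntil_subset_support _ hx)
      -- If `a = b`, the edge to `M` is a spike traversed back and forth.
      · by_cases hab : a = b
        · subst hab
          have : walkClass p = .refl _ := by
            refine ih _ ?_ p rfl hw'
            rw [← hqn, walkWeight, walkWeight_append]; lia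
          simp only [walkClass, walkClass_append, this, Path.Homotopic.Quotient.refl_trans,
            Path.Homotopic.Quotient.trans_refl]
          rw [linClass_trans (convex_gridRect δ M.1 a.1) h1.2 (x := vtx M) (y := vtx a)
            (z := vtx M) (left_mem_gridRect _ _ _) (right_mem_gridRect _ _ _)
            (left_mem_gridRect _ _ _), linClass_self]
          · rw [segment_same, singleton_subset_iff]; exact M.2
        · have hmax' : ∀ x ∈ p.support, x.1.2 < M.1.2 ∨ (x.1.2 = M.1.2 ∧ x.1.1 ≤ M.1.1) :=
            fun x hx => hmax x (by simp [SimpleGraph.Walk.mem_support_append_iff, hx])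
          obtain ⟨hsq, hdir⟩ := gridRect_subset_of_corner hδ hconn h1 p h2 hMp hmax' hab
          have hcΩ := hsq (left_mem_gridRect _ _ _)
          let c : {u : ℤ × ℤ // gridPt δ u ∈ Ω} := ⟨_, hcΩ⟩
          have hC := convex_gridRect δ c.1 M.1
          have hcorner : ∀ d : ℤ × ℤ, (d = (M.1.1 - 1, M.1.2) ∨ d = (M.1.1, M.1.2 - 1)) →
              gridPt δ d ∈ gridRect δ c.1 M.1 := by
            rintro d (rfl | rfl)
            · exact ⟨left_mem_uIcc, right_mem_uIcc⟩
            · exact ⟨right_mem_uIcc, left_mem_uIcc⟩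
          have hcornerR : ∀ d : ℤ × ℤ, (d = (M.1.1 - 1, M.1.2) ∨ d = (M.1.1, M.1.2 - 1)) →
              gridRect δ c.1 d ⊆ Ω := by
            refine fun d hd => Subset.trans (fun e he => ?_) hsq
            have h3 := hcorner d hd
            have h4 := left_mem_gridRect δ c.1 M.1
            exact ⟨uIcc_subset_uIcc h4.1 h3.1 he.1, uIcc_subset_uIcc h4.2 h3.2 he.2⟩
          have hstep : ∀ d : ℤ × ℤ, (d = (M.1.1 - 1, M.1.2) ∨ d = (M.1.1, M.1.2 - 1)) →
              UnitStep c.1 d := by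
            rintro d (rfl | rfl) <;> simp [UnitStep, c]
          have ha : a.1 = (M.1.1 - 1, M.1.2) ∨ a.1 = (M.1.1, M.1.2 - 1) := by tauto
          have hb : b.1 = (M.1.1 - 1, M.1.2) ∨ b.1 = (M.1.1, M.1.2 - 1) := by tauto
          have h1' : (gridGraph Ω δ).Adj c a := ⟨hstep _ ha, hcornerR _ ha⟩
          have h2' : (gridGraph Ω δ).Adj b c := SimpleGraph.Adj.symm ⟨hstep _ hb, hcornerR _ hb⟩
          -- The corner `c` takes its column from the left neighbour of `M` and its row from the
          -- lower one, so the bound persists.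
          have hcm : m ≤ c.1.1 ∧ m ≤ c.1.2 := by
            have e1 := hw' a p.start_mem_support
            have e2 := hw' b p.end_mem_support
            change m ≤ M.1.1 - 1 ∧ m ≤ M.1.2 - 1
            rcases hdir with ⟨h3, h4⟩ | ⟨h3, h4⟩ <;> simp only [h3, h4] at e1 e2 <;> lia
          refine walkClass_push hC hsq (right_mem_gridRect _ _ _) (hcorner _ ha) (hcorner _ hb)
            (left_mem_gridRect _ _ _) h1 p h2 h1' h2' (ih _ ?_ _ rfl ?_)
          · rw [← hqn]
            simp only [walkWeight, walkWeight_append]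
            have : c.1.1 = M.1.1 - 1 := rfl
            have : c.1.2 = M.1.2 - 1 := rfl
            lia
          · intro x hx
            simp only [SimpleGraph.Walk.support_cons, SimpleGraph.Walk.support_nil,
              SimpleGraph.Walk.mem_support_append_iff, List.mem_cons, List.not_mem_nil,
              or_false] at hx
            rcases hx with rfl | hx | rfl | rfl
            · exact hcm
            · exact hw' x hx
            · exact hw' _ p.end_mem_support
            · exact hcm

/-- Closed grid walks are null-homotopic when the complement is connected. -/
lemma walkClass_eq_refl (hδ : 0 < δ) (hconn : IsPreconnected (((↑) : ℂ → OnePoint ℂ) '' Ω)ᶜ)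
    {v : {u : ℤ × ℤ // gridPt δ u ∈ Ω}} (w : (gridGraph Ω δ).Walk v v) :
    walkClass w = .refl _ := by
  obtain ⟨B, -, hB⟩ := exists_bound_support w
  refine walkClass_eq_refl_aux hδ hconn (-B) _ w rfl fun x hx => ?_
  have := hB x hx
  exact ⟨(abs_lt.1 this.1).1.le, (abs_lt.1 this.2).1.le⟩

end RationalDynamics

end

/-! ### Approximation of loops by grid walks -/

noncomputable section

namespace RationalDynamics

open Set Filter Topology
open scoped unitInterval

variable {Ω : Set ℂ} {δ : ℝ}

/-- An open box around a point. -/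
def gridBox (δ : ℝ) (z : ℂ) : Set ℂ :=
  Ioo (z.re - 3 * δ) (z.re + 3 * δ) ×ℂ Ioo (z.im - 3 * δ) (z.im + 3 * δ)

lemma convex_gridBox (δ : ℝ) (z : ℂ) : Convex ℝ (gridBox δ z) :=
  ((convex_Ioo _ _).linear_preimage Complex.reLm).inter
    ((convex_Ioo _ _).linear_preimage Complex.imLm)

/-- The grid vertex obtained by rounding down the coordinates of a point. -/
def gridFloor (δ : ℝ) (z : ℂ) : ℤ × ℤ := (⌊z.re / δ⌋, ⌊z.im / δ⌋)

lemma mul_floor_mem (hδ : 0 < δ) (x : ℝ) : x - δ < δ * ⌊x / δ⌋ ∧ δ * ⌊x / δ⌋ ≤ x := by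
  have h1 := Int.floor_le (x / δ)
  have h2 := Int.lt_floor_add_one (x / δ)
  rw [le_div_iff₀ hδ] at h1
  rw [div_lt_iff₀ hδ] at h2
  constructor <;> linarith

lemma self_mem_gridBox (hδ : 0 < δ) (z : ℂ) : z ∈ gridBox δ z :=
  ⟨⟨by linarith, by linarith⟩, ⟨by linarith, by linarith⟩⟩

lemma gridPt_gridFloor_mem (hδ : 0 < δ) (z : ℂ) : gridPt δ (gridFloor δ z) ∈ gridBox δ z := by
  have h1 := mul_floor_mem hδ z.re
  have h2 := mul_floor_mem hδ z.im
  refine ⟨⟨?_, ?_⟩, ⟨?_, ?_⟩⟩ <;> simp only [gridPt, gridFloor] <;> linarith [h1.1, h1.2, h2.1, h2.2]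

lemma gridRect_subset_gridBox {z : ℂ} {u v : ℤ × ℤ} (hu : gridPt δ u ∈ gridBox δ z)
    (hv : gridPt δ v ∈ gridBox δ z) : gridRect δ u v ⊆ gridBox δ z := fun _ he =>
  ⟨ordConnected_Ioo.uIcc_subset hu.1 hv.1 he.1, ordConnected_Ioo.uIcc_subset hu.2 hv.2 he.2⟩

lemma exists_walk_of_step {z : ℂ} (hz : gridBox δ z ⊆ Ω) {u v : {u : ℤ × ℤ // gridPt δ u ∈ Ω}}
    (hu : gridPt δ u ∈ gridBox δ z) (hv : gridPt δ v ∈ gridBox δ z)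
    (huv : (u.1.1 = v.1.1 ∧ |u.1.2 - v.1.2| ≤ 1) ∨ (u.1.2 = v.1.2 ∧ |u.1.1 - v.1.1| ≤ 1)) :
    ∃ W : (gridGraph Ω δ).Walk u v, walkClass W = linClass (vtx u) (vtx v)
      (segment_vtx_subset ((gridRect_subset_gridBox hu hv).trans hz)) := by
  by_cases h : u = v
  · subst h
    exact ⟨.nil, by rw [linClass_self]; rfl⟩
  · have hadj : (gridGraph Ω δ).Adj u v := by
      refine ⟨?_, (gridRect_subset_gridBox hu hv).trans hz⟩
      have h' : u.1 ≠ v.1 := fun h' => h (Subtype.ext h')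
      rw [Ne, Prod.ext_iff] at h'
      unfold UnitStep
      rw [abs_le, abs_le] at huv
      lia
    exact ⟨.cons hadj .nil, by simp [walkClass]⟩

lemma segment_gridFloor_subset (hδ : 0 < δ) {z : Ω} (hz : gridBox δ z ⊆ Ω) :
    segment ℝ (z : ℂ) (vtx (⟨gridFloor δ z, hz (gridPt_gridFloor_mem hδ z)⟩ :
      {u : ℤ × ℤ // gridPt δ u ∈ Ω})) ⊆ Ω :=
  ((convex_gridBox δ z).segment_subset (self_mem_gridBox hδ z) (gridPt_gridFloor_mem hδ z)).trans hz

/-- The path class `Q` is a grid walk, up to short straight paths at the ends. -/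
def HasWalk (hδ : 0 < δ) {z z' : Ω} (Q : Path.Homotopic.Quotient z z') : Prop :=
  ∃ (hz : gridBox δ z ⊆ Ω) (hz' : gridBox δ z' ⊆ Ω)
    (W : (gridGraph Ω δ).Walk ⟨gridFloor δ z, hz (gridPt_gridFloor_mem hδ z)⟩
      ⟨gridFloor δ z', hz' (gridPt_gridFloor_mem hδ z')⟩),
    Q.trans (linClass _ _ (segment_gridFloor_subset hδ hz')) =
      (linClass _ _ (segment_gridFloor_subset hδ hz)).trans (walkClass W)

lemma HasWalk.trans {hδ : 0 < δ} {x y z : Ω} {P : Path.Homotopic.Quotient x y}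
    {Q : Path.Homotopic.Quotient y z} (hP : HasWalk hδ P) (hQ : HasWalk hδ Q) :
    HasWalk hδ (P.trans Q) := by
  obtain ⟨hx, hy, W, h1⟩ := hP
  obtain ⟨hy', hz, W', h2⟩ := hQ
  refine ⟨hx, hz, W.append W', ?_⟩
  rw [walkClass_append, Path.Homotopic.Quotient.trans_assoc, h2,
    ← Path.Homotopic.Quotient.trans_assoc, h1, Path.Homotopic.Quotient.trans_assoc]

/-- The rounded coordinates change by at most one each, so one horizontal and one vertical step
suffice. All paths stay in the box of half-width `3 * δ`, whose convexity supplies the homotopy. -/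
lemma HasWalk.of_short (hδ : 0 < δ) {z z' : Ω} (hz : gridBox δ z ⊆ Ω) (hz' : gridBox δ z' ⊆ Ω)
    (p : Path z z') (hp : ∀ t, (p t : ℂ) ∈ gridBox δ z) (hre : |(z' : ℂ).re - (z : ℂ).re| < δ)
    (him : |(z' : ℂ).im - (z : ℂ).im| < δ) :
    HasWalk hδ (Path.Homotopic.Quotient.mk p) := by
  have hfl : ∀ x y : ℝ, |y - x| < δ → |⌊y / δ⌋ - ⌊x / δ⌋| ≤ 1 := by
    intro x y h
    have h1 := Int.floor_le (x / δ)
    have h2 := Int.lt_floor_add_one (x / δ)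
    have h3 := Int.floor_le (y / δ)
    have h4 := Int.lt_floor_add_one (y / δ)
    have h5 : |y / δ - x / δ| < 1 := by
      rw [← sub_div, abs_div, abs_of_pos hδ, div_lt_one hδ]; exact h
    rw [abs_lt] at h5
    have h6 : ((⌊y / δ⌋ - ⌊x / δ⌋ : ℤ) : ℝ) < 2 := by push_cast; linarith [h5.1, h5.2]
    have h7 : (-2 : ℝ) < ((⌊y / δ⌋ - ⌊x / δ⌋ : ℤ) : ℝ) := by push_cast; linarith [h5.1, h5.2]
    have h6' : ⌊y / δ⌋ - ⌊x / δ⌋ < 2 := by exact_mod_cast h6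
    have h7' : -2 < ⌊y / δ⌋ - ⌊x / δ⌋ := by exact_mod_cast h7
    rw [abs_le]; lia
  have g1 := hfl _ _ hre
  have g2 := hfl _ _ him
  rw [abs_lt] at hre him
  have hu := gridPt_gridFloor_mem hδ (z : ℂ)
  have b1 := mul_floor_mem hδ (z' : ℂ).re
  have b2 := mul_floor_mem hδ (z' : ℂ).im
  have b3 := mul_floor_mem hδ (z : ℂ).im
  have hv : gridPt δ (gridFloor δ z') ∈ gridBox δ z := by
    refine ⟨⟨?_, ?_⟩, ⟨?_, ?_⟩⟩ <;> simp only [gridPt, gridFloor] <;>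
      linarith [b1.1, b1.2, b2.1, b2.2, hre.1, hre.2, him.1, him.2]
  have hw : gridPt δ ((gridFloor δ z').1, (gridFloor δ z).2) ∈ gridBox δ z := ⟨hv.1, hu.2⟩
  let u : {u : ℤ × ℤ // gridPt δ u ∈ Ω} := ⟨gridFloor δ z, hz hu⟩
  let v : {u : ℤ × ℤ // gridPt δ u ∈ Ω} := ⟨gridFloor δ z', hz hv⟩
  let w : {u : ℤ × ℤ // gridPt δ u ∈ Ω} := ⟨_, hz hw⟩
  obtain ⟨W1, hW1⟩ := exists_walk_of_step hz (u := u) (v := w) hu hw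
    (Or.inr ⟨rfl, by rw [abs_sub_comm]; exact g1⟩)
  obtain ⟨W2, hW2⟩ := exists_walk_of_step hz (u := w) (v := v) hw hv
    (Or.inl ⟨rfl, by rw [abs_sub_comm]; exact g2⟩)
  refine ⟨hz, hz', W1.append W2, ?_⟩
  have hC := convex_gridBox δ z
  have hzz := self_mem_gridBox hδ (z : ℂ)
  have hzz' : (z' : ℂ) ∈ gridBox δ z := by simpa using hp 1
  have e1 : segment ℝ (vtx u : ℂ) (vtx v) ⊆ Ω := (hC.segment_subset hu hv).trans hz
  have e2 : segment ℝ (z : ℂ) (vtx v) ⊆ Ω := (hC.segment_subset hzz hv).trans hz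
  rw [walkClass_append, hW1, hW2,
    linClass_trans hC hz (x := vtx u) (y := vtx w) (z := vtx v) hu hw hv _ _ e1]
  refine Eq.trans ?_ (linClass_trans hC hz (x := z) (y := vtx u) (z := vtx v) hzz hu hv _ e1 e2).symm
  rw [linClass, linClass, ← Path.Homotopic.Quotient.mk_trans]
  exact mk_eq_mk_of_convex hC hz _ _ (trans_mem hp (linPath_mem hC _ hzz' hv))
    (linPath_mem hC _ hzz hv)

lemma HasWalk.cast {hδ : 0 < δ} {x y x' y' : Ω} {P : Path.Homotopic.Quotient x y}
    (hP : HasWalk hδ P) (hx : x' = x) (hy : y' = y) : HasWalk hδ (P.cast hx hy) := by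
  subst hx hy
  simpa using hP

/-- A connected open subset of the plane is simply connected if its complement in the sphere is
connected. -/
theorem isSimplyConnected_of_isPreconnected_compl_image {Ω : Set ℂ} (hΩ : IsOpen Ω)
    (hc : IsConnected Ω) (hconn : IsPreconnected (((↑) : ℂ → OnePoint ℂ) '' Ω)ᶜ) :
    IsSimplyConnected Ω := by
  rw [IsSimplyConnected, simply_connected_iff_loops_nullhomotopic]
  refine ⟨isPathConnected_iff_pathConnectedSpace.1 (hΩ.isConnected_iff_isPathConnected.1 hc), ?_⟩
  intro x γ
  let g : I → ℂ := fun t => γ t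
  have hg : Continuous g := by fun_prop
  obtain ⟨ε, hε, hthick⟩ := (isCompact_range hg).exists_thickening_subset_open hΩ
    (by rintro _ ⟨t, rfl⟩; exact (γ t).2)
  -- A point of the box differs from its centre by less than `3 * δ` in each coordinate, hence by
  -- less than `6 * δ` in norm.
  obtain ⟨δ, hδ, hδε⟩ : ∃ δ : ℝ, 0 < δ ∧ 6 * δ = ε := ⟨ε / 6, by positivity, by ring⟩
  have hbox : ∀ t, gridBox δ (γ t : ℂ) ⊆ Ω := by
    intro t e he
    apply hthick
    rw [Metric.mem_thickening_iff]
    refine ⟨γ t, ⟨t, rfl⟩, ?_⟩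
    have h1 := Complex.norm_le_abs_re_add_abs_im (e - γ t)
    have h2 : |(e - γ t).re| < 3 * δ := by
      rw [Complex.sub_re, abs_lt]; constructor <;> linarith [he.1.1, he.1.2]
    have h3 : |(e - γ t).im| < 3 * δ := by
      rw [Complex.sub_im, abs_lt]; constructor <;> linarith [he.2.1, he.2.2]
    rw [dist_eq_norm]
    linarith
  obtain ⟨η, hη, hunif⟩ := Metric.uniformContinuous_iff.1
    (CompactSpace.uniformContinuous_of_continuous hg) δ hδ
  obtain ⟨n, hn⟩ := exists_nat_one_div_lt hη
  -- Clamping defines the subdivision for every natural `k`; the end of the loop is reached at `k =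
  -- n + 1`.
  let t : ℕ → I := fun k => projIcc 0 1 zero_le_one ((k : ℝ) / (n + 1))
  have ht : ∀ k, dist (t k) (t (k + 1)) < η := by
    intro k
    have h1 := (LipschitzWith.projIcc (zero_le_one (α := ℝ))).dist_le_mul ((k : ℝ) / (n + 1))
      (((k + 1 : ℕ) : ℝ) / (n + 1))
    refine h1.trans_lt (lt_of_eq_of_lt ?_ hn)
    rw [Real.dist_eq, ← sub_div, abs_div, abs_of_pos (a := (n : ℝ) + 1) (by positivity)]
    push_cast
    simp
  have hstep : ∀ k, HasWalk hδ (Path.Homotopic.Quotient.mk (γ.subpath (t k) (t (k + 1)))) := by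
    intro k
    have hclose : ∀ s ∈ uIcc (t k) (t (k + 1)), dist (g s) (g (t k)) < δ := by
      intro s hs
      apply hunif
      refine lt_of_le_of_lt ?_ (ht k)
      rw [Subtype.dist_eq, Subtype.dist_eq, dist_comm (t k : ℝ)]
      apply Real.dist_le_of_mem_uIcc ?_ ?_ |>.trans (le_of_eq ?_)
      · exact (t (k + 1) : ℝ)
      · exact (t k : ℝ)
      · rcases mem_uIcc.1 hs with h | h
        · exact mem_uIcc.2 (Or.inr h)
        · exact mem_uIcc.2 (Or.inl h)
      · exact right_mem_uIcc
      · rfl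
    refine HasWalk.of_short hδ (hbox _) (hbox _) _ (fun s => ?_) ?_ ?_
    · have : γ.subpath (t k) (t (k + 1)) s ∈ γ '' uIcc (t k) (t (k + 1)) := by
        rw [← Path.range_subpath]; exact mem_range_self s
      obtain ⟨r, hr, hr'⟩ := this
      rw [← hr']
      have h1 := hclose r hr
      rw [dist_eq_norm] at h1
      have h2 := (Complex.abs_re_le_norm _).trans_lt h1
      have h3 := (Complex.abs_im_le_norm _).trans_lt h1
      rw [Complex.sub_re, abs_lt] at h2
      rw [Complex.sub_im, abs_lt] at h3
      exact ⟨⟨by linarith [h2.1], by linarith [h2.2]⟩, ⟨by linarith [h3.1], by linarith [h3.2]⟩⟩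
    · have h1 := hclose _ right_mem_uIcc
      rw [dist_eq_norm] at h1
      exact (Complex.abs_re_le_norm _).trans_lt h1
    · have h1 := hclose _ right_mem_uIcc
      rw [dist_eq_norm] at h1
      exact (Complex.abs_im_le_norm _).trans_lt h1
  have hall : ∀ k, HasWalk hδ (Path.Homotopic.Quotient.mk (γ.subpath (t 0) (t k))) := by
    intro k
    induction k with
    | zero =>
      rw [Path.subpath_self]
      exact HasWalk.of_short hδ (hbox _) (hbox _) _ (fun s => self_mem_gridBox hδ _) (by simpa)
        (by simpa)
    | succ k ih =>
      have := ih.trans (hstep k)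
      rw [← Path.Homotopic.Quotient.mk_trans] at this
      rwa [← (Path.Homotopic.Quotient.eq).2 ⟨Path.Homotopy.subpathTransSubpath γ (t 0) (t k)
        (t (k + 1))⟩]
  have h0 : t 0 = 0 := by
    ext; simp [t]
  have h1 : t (n + 1) = 1 := by
    have : ((n : ℝ) + 1) / (n + 1) = 1 := div_self (by positivity)
    ext; simp [t, this]
  have hfin := hall (n + 1)
  rw [h0, h1, Path.subpath_zero_one, Path.Homotopic.Quotient.mk_cast] at hfin
  replace hfin := hfin.cast γ.source.symm γ.target.symm
  rw [Path.Homotopic.Quotient.cast_cast, Path.Homotopic.Quotient.cast_rfl_rfl] at hfin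
  obtain ⟨hz, hz', W, hW⟩ := hfin
  -- Now `γ` followed by the short segment equals that segment, which can be cancelled.
  rw [walkClass_eq_refl hδ hconn W, Path.Homotopic.Quotient.trans_refl] at hW
  rw [← Path.Homotopic.Quotient.eq, Path.Homotopic.Quotient.mk_refl]
  have := congrArg (fun q => q.trans (linClass _ _ (segment_gridFloor_subset hδ hz)).symm) hW
  simpa only [Path.Homotopic.Quotient.trans_assoc, Path.Homotopic.Quotient.trans_symm,
    Path.Homotopic.Quotient.trans_refl] using this

end RationalDynamics

end

/-! ### Möbius maps, simple connectivity on the sphere, unicoherence -/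

noncomputable section

namespace RationalDynamics

open Set Filter Topology
open scoped OnePoint

lemma proj_eq_proj_coords {Φ : ℂ × ℂ → ℂ × ℂ} {d : ℕ} (hhom : ∀ (c : ℂ) x, Φ (c • x) = c ^ d • Φ x)
    {x : ℂ × ℂ} (hx : x ≠ 0) : proj (Φ x) = proj (Φ (coords (proj x))) := by
  obtain ⟨c, hc, h⟩ := exists_smul_eq_of_proj_eq (coords_ne_zero (proj x)) hx (proj_coords _)
  conv_lhs => rw [h, hhom, proj_smul (pow_ne_zero _ hc)]

lemma HasLift.of_homogeneous {Φ : ℂ × ℂ → ℂ × ℂ} {d : ℕ} (hd : Differentiable ℂ Φ)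
    (h0 : ∀ x, x ≠ 0 → Φ x ≠ 0) (hhom : ∀ (c : ℂ) x, Φ (c • x) = c ^ d • Φ x) :
    HasLift (fun s => proj (Φ (coords s))) Φ :=
  ⟨hd, h0, fun _ hx => proj_eq_proj_coords hhom hx⟩

/-- A Möbius transformation sending a given point to `∞`. -/
lemma exists_mobius (e : OnePoint ℂ) : ∃ (M : OnePoint ℂ ≃ₜ OnePoint ℂ) (Φ Ψ : ℂ × ℂ → ℂ × ℂ),
    HasLift M Φ ∧ HasLift M.symm Ψ ∧ M e = ∞ := by
  obtain ⟨⟨a, b⟩, hab⟩ : ∃ a : ℂ × ℂ, a = coords e := ⟨_, rfl⟩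
  -- The second row annihilates `(a, b)`. The conjugates in the first row make the determinant `|a|²
  -- + |b|²`, and `Ψ` is the adjugate.
  let Φ : ℂ × ℂ → ℂ × ℂ := fun x => (star a * x.1 + star b * x.2, -b * x.1 + a * x.2)
  let Ψ : ℂ × ℂ → ℂ × ℂ := fun x => (a * x.1 - star b * x.2, b * x.1 + star a * x.2)
  let D : ℂ := a * star a + b * star b
  have hD : D ≠ 0 := by
    have h0 := coords_ne_zero e
    rw [← hab] at h0
    have h1 : D = ((Complex.normSq a + Complex.normSq b : ℝ) : ℂ) := by
      simp only [D, Complex.star_def, Complex.mul_conj]; push_cast; rfl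
    rw [h1, Complex.ofReal_ne_zero]
    intro h2
    apply h0
    have h3 := Complex.normSq_nonneg a
    have h4 := Complex.normSq_nonneg b
    exact Prod.ext (Complex.normSq_eq_zero.1 (by linarith)) (Complex.normSq_eq_zero.1 (by linarith))
  have h1 : ∀ x, Ψ (Φ x) = D • x := fun x => by
    ext <;> simp only [Ψ, Φ, D, Prod.smul_fst, Prod.smul_snd, smul_eq_mul] <;> ring
  have h2 : ∀ x, Φ (Ψ x) = D • x := fun x => by
    ext <;> simp only [Ψ, Φ, D, Prod.smul_fst, Prod.smul_snd, smul_eq_mul] <;> ring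
  have hΦ0 : Φ 0 = 0 := by simp [Φ]
  have hΨ0 : Ψ 0 = 0 := by simp [Ψ]
  have hΦ : HasLift (fun s => proj (Φ (coords s))) Φ := by
    refine HasLift.of_homogeneous (d := 1) (by fun_prop) (fun x hx h => hx ?_) fun c x => ?_
    · have := h1 x
      rw [h, hΨ0] at this
      exact (smul_eq_zero.1 this.symm).resolve_left hD
    · ext <;> simp only [Φ, Prod.smul_fst, Prod.smul_snd, smul_eq_mul] <;> ring
  have hΨ : HasLift (fun s => proj (Ψ (coords s))) Ψ := by
    refine HasLift.of_homogeneous (d := 1) (by fun_prop) (fun x hx h => hx ?_) fun c x => ?_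
    · have := h2 x
      rw [h, hΦ0] at this
      exact (smul_eq_zero.1 this.symm).resolve_left hD
    · ext <;> simp only [Ψ, Prod.smul_fst, Prod.smul_snd, smul_eq_mul] <;> ring
  refine ⟨⟨⟨_, _, ?_, ?_⟩, hΦ.continuous, hΨ.continuous⟩, Φ, Ψ, hΦ, hΨ, ?_⟩
  · intro s
    have := hΨ.3 _ (hΦ.2 _ (coords_ne_zero s))
    rw [h1, proj_smul hD, proj_coords] at this
    exact this.symm
  · intro s
    have := hΦ.3 _ (hΨ.2 _ (coords_ne_zero s))
    rw [h2, proj_smul hD, proj_coords] at this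
    exact this.symm
  · change proj (Φ (coords e)) = ∞
    rw [← hab]
    simp [Φ, proj, mul_comm]

lemma image_preimage_coe_of_infty_notMem {s : Set (OnePoint ℂ)} (h : ∞ ∉ s) :
    ((↑) : ℂ → OnePoint ℂ) '' ((↑) ⁻¹' s) = s := by
  rw [image_preimage_eq_inter_range, inter_eq_left]
  intro x hx
  rw [← OnePoint.compl_infty]
  rintro rfl
  exact h hx

/-- A connected open proper subset of the sphere is simply connected if its complement is
connected. -/
theorem isSimplyConnected_of_isConnected_compl {U : Set (OnePoint ℂ)} (hU : IsOpen U)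
    (hc : IsConnected U) (hconn : IsConnected Uᶜ) : IsSimplyConnected U := by
  obtain ⟨e, he⟩ := hconn.nonempty
  obtain ⟨M, -, -, -, -, hM⟩ := exists_mobius e
  have hinf : ∞ ∉ M '' U := by
    rintro ⟨x, hx, h⟩
    rw [← hM] at h
    exact he (M.injective h ▸ hx)
  have himg := image_preimage_coe_of_infty_notMem hinf
  have hemb := (OnePoint.isOpenEmbedding_coe (X := ℂ)).isEmbedding
  rw [← M.isSimplyConnected_image, ← himg, hemb.isSimplyConnected_image]
  apply isSimplyConnected_of_isPreconnected_compl_image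
  · exact ((M.isOpen_image).2 hU).preimage OnePoint.continuous_coe
  · refine ⟨?_, ?_⟩
    · have := hc.nonempty.image M
      rw [← himg] at this
      exact this.of_image
    · rw [← hemb.isInducing.isPreconnected_image, himg]
      exact hc.isPreconnected.image M M.continuous.continuousOn
  · rw [himg, ← image_compl_eq M.bijective]
    exact hconn.isPreconnected.image M M.continuous.continuousOn

/-- Uniqueness of lifts through the covering `exp`, applied to a constant map. -/
lemma eq_of_exp_const {X : Type*} [TopologicalSpace X] {s : Set X} (hs : IsPreconnected s)
    {k : X → ℂ} (hk : ContinuousOn k s)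
    (h : ∀ a ∈ s, ∀ b ∈ s, Complex.exp (k a) = Complex.exp (k b)) {a b : X} (ha : a ∈ s)
    (hb : b ∈ s) : k a = k b :=
  (T2Space.isSeparatedMap _).constOn_of_comp
    Complex.isCoveringMap_exp.isLocalHomeomorph.isLocallyInjective hs hk
    (fun a ha b hb => Subtype.ext (h a ha b hb)) ha hb

lemma isSimplyConnected_univ_complex : IsSimplyConnected (univ : Set ℂ) := by
  have : ContractibleSpace (univ : Set ℂ) := convex_univ.contractibleSpace univ_nonempty
  exact SimplyConnectedSpace.ofContractible _

/-- A nonvanishing function on the plane does not wind around a large circle. -/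
lemma not_eventually_eq_sub {G : ℂ → ℂ} (hG : Continuous G) (h0 : ∀ z, G z ≠ 0) (a : ℂ) {r : ℝ}
    (hr : ∀ z, r < ‖z - a‖ → G z = z - a) : False := by
  obtain ⟨H, hH, hexp⟩ := Complex.exists_continuousOn_eqOn_exp_comp isSimplyConnected_univ_complex
    isOpen_univ hG.continuousOn (by rintro ⟨z, -, hz⟩; exact h0 z hz)
  have hH' : Continuous H := continuousOn_univ.1 hH
  set ρ : ℝ := |r| + 1
  have hρ : 0 < ρ := by positivity
  have hρr : r < ρ := (le_abs_self r).trans_lt (lt_add_one _)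
  let c : ℝ → ℂ := fun θ => a + ρ * Complex.exp (θ * Complex.I)
  -- The exponential of `k` is the constant `ρ`, so `k` is constant; yet a full turn returns `c` to
  -- its start and changes `k` by `-2πi`.
  let k : ℝ → ℂ := fun θ => H (c θ) - θ * Complex.I
  have hk : Continuous k := by fun_prop
  have hkexp : ∀ θ, Complex.exp (k θ) = ρ := by
    intro θ
    have h1 : Complex.exp (H (c θ)) = G (c θ) := hexp (mem_univ _)
    rw [Complex.exp_sub, h1, hr]
    · simp only [c, add_sub_cancel_left]
      rw [mul_div_assoc, div_self (Complex.exp_ne_zero _), mul_one]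
    · simp only [c, add_sub_cancel_left, norm_mul, Complex.norm_exp_ofReal_mul_I, mul_one,
        Complex.norm_real, Real.norm_of_nonneg hρ.le]
      exact hρr
  have := eq_of_exp_const isPreconnected_univ hk.continuousOn
    (fun a _ b _ => by rw [hkexp, hkexp]) (mem_univ 0) (mem_univ (2 * Real.pi))
  simp only [k, c] at this
  push_cast at this
  rw [Complex.exp_two_pi_mul_I, zero_mul, Complex.exp_zero] at this
  have h3 : (Real.pi : ℂ) * Complex.I = 0 := by linear_combination (1 / 2) * this
  simp [Real.pi_ne_zero] at h3

/-- With `L` a logarithm of `z - a` on `U` and a cutoff `φ` from 0 near `A` to 1 near `B`, the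
function `exp (φ L)` extends by 1 over `A` and by `z - a` over `B`. It is a nonvanishing function on
the plane equal to `z - a` near `∞`, which is impossible. -/
lemma false_of_isSimplyConnected_of_separated {U A B : Set (OnePoint ℂ)} (hU : IsOpen U)
    (hsc : IsSimplyConnected U) (hA : IsClosed A) (hB : IsClosed B) (hAB : Disjoint A B)
    (hUAB : Uᶜ = A ∪ B) (hinf : ∞ ∈ B) (hne : A.Nonempty) : False := by
  obtain ⟨a, ha⟩ := hne
  have ha' : a ≠ ∞ := by rintro rfl; exact hAB.notMem_of_mem_left ha hinf
  lift a to ℂ using ha'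
  have hU' : U = (A ∪ B)ᶜ := by rw [← hUAB, compl_compl]
  have hUA : ∀ x ∈ U, x ∉ A := fun x hx hx' => by rw [hU'] at hx; exact hx (Or.inl hx')
  have hUB : ∀ x ∈ U, x ∉ B := fun x hx hx' => by rw [hU'] at hx; exact hx (Or.inr hx')
  obtain ⟨L, hL, hLexp⟩ := Complex.exists_continuousOn_eqOn_exp_comp hsc hU
    (g := fun s : OnePoint ℂ => s.elim 1 (fun z => z - a)) (by
      intro s hs
      have hs' : s ≠ ∞ := by rintro rfl; exact hUB _ hs hinf
      lift s to ℂ using hs'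
      refine ContinuousAt.continuousWithinAt ?_
      rw [OnePoint.continuousAt_coe]
      change ContinuousAt (fun z : ℂ => z - a) s
      fun_prop) (by
      rintro ⟨s, hs, h⟩
      have hs' : s ≠ ∞ := by rintro rfl; exact hUB _ hs hinf
      lift s to ℂ using hs'
      have h' : s - a = 0 := h
      rw [sub_eq_zero] at h'
      subst h'
      exact hUA _ hs ha)
  have hLexp' : ∀ z : ℂ, (z : OnePoint ℂ) ∈ U → Complex.exp (L z) = z - a := fun z hz => hLexp hz
  obtain ⟨f, hf0, hf1, hf⟩ := exists_continuous_zero_one_of_isClosed hA hB hAB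
  -- Truncation makes the cutoff constant on neighbourhoods of `A` and `B`, not only on the sets, so
  -- that the pieces of `G` glue continuously.
  let φ : OnePoint ℂ → ℝ := fun s => max 0 (min 1 (3 * f s - 1))
  have hφ : Continuous φ := by fun_prop
  have hφ0 : ∀ s, f s < 1 / 3 → φ s = 0 := fun s hs => by
    simp only [φ]; rw [max_eq_left]; exact (min_le_right _ _).trans (by linarith)
  have hφ1 : ∀ s, 2 / 3 < f s → φ s = 1 := fun s hs => by
    simp only [φ]; rw [min_eq_left (by linarith)]; simp
  classical
  let G : ℂ → ℂ := fun z => if (z : OnePoint ℂ) ∈ A then 1 else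
    if (z : OnePoint ℂ) ∈ B then z - a else Complex.exp (φ z * L z)
  have hGA : ∀ z : ℂ, f z < 1 / 3 → G z = 1 := by
    intro z hz
    by_cases h1 : (z : OnePoint ℂ) ∈ A
    · simp [G, h1]
    · have h2 : (z : OnePoint ℂ) ∉ B := fun h => by
        rw [hf1 h] at hz; norm_num at hz
      simp [G, h1, h2, hφ0 _ hz]
  have hGB : ∀ z : ℂ, 2 / 3 < f z → G z = z - a := by
    intro z hz
    have h1 : (z : OnePoint ℂ) ∉ A := fun h => by
      rw [hf0 h] at hz; norm_num at hz
    by_cases h2 : (z : OnePoint ℂ) ∈ B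
    · simp [G, h1, h2]
    · have h3 : (z : OnePoint ℂ) ∈ U := by rw [hU']; simp [h1, h2]
      simp [G, h1, h2, hφ1 _ hz, hLexp' z h3]
  have hfc : Continuous fun z : ℂ => f z := f.continuous.comp OnePoint.continuous_coe
  have hG0 : ∀ z, G z ≠ 0 := by
    intro z
    by_cases h1 : (z : OnePoint ℂ) ∈ A
    · simp [G, h1]
    · by_cases h2 : (z : OnePoint ℂ) ∈ B
      · simp only [G, h1, h2, if_true, if_false, sub_ne_zero]
        rintro rfl
        exact h1 ha
      · simp [G, h1, h2]
  have hGc : Continuous G := by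
    rw [continuous_iff_continuousAt]
    intro z
    by_cases h1 : (z : OnePoint ℂ) ∈ A
    · have : ∀ᶠ w : ℂ in 𝓝 z, G w = 1 := by
        have h3 : f z < 1 / 3 := by rw [hf0 h1]; norm_num
        filter_upwards [hfc.continuousAt.eventually_lt_const h3] with w hw using hGA w hw
      exact (continuousAt_congr this).2 continuousAt_const
    · by_cases h2 : (z : OnePoint ℂ) ∈ B
      · have : G =ᶠ[𝓝 z] fun w => w - a := by
          have h3 : 2 / 3 < f z := by rw [hf1 h2]; norm_num
          filter_upwards [hfc.continuousAt.eventually_const_lt h3] with w hw using hGB w hw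
        exact (continuousAt_congr this).2 (by fun_prop)
      · have h3 : (z : OnePoint ℂ) ∈ U := by rw [hU']; simp [h1, h2]
        have : G =ᶠ[𝓝 z] fun w : ℂ => Complex.exp (φ w * L w) := by
          filter_upwards [(hU.preimage OnePoint.continuous_coe).mem_nhds h3] with w hw
          simp [G, hUA _ hw, hUB _ hw]
        refine (continuousAt_congr this).2 ?_
        have hL1 : ContinuousAt (fun w : ℂ => L w) z :=
          ContinuousAt.comp (f := ((↑) : ℂ → OnePoint ℂ)) (hL.continuousAt (hU.mem_nhds h3))
            OnePoint.continuous_coe.continuousAt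
        have hφ2 : Continuous fun w : ℂ => (φ w : ℂ) :=
          Complex.continuous_ofReal.comp (hφ.comp OnePoint.continuous_coe)
        exact (hφ2.continuousAt.mul hL1).cexp
  have hev : ∀ᶠ z : ℂ in cocompact ℂ, 2 / 3 < f z := by
    have h1 : Tendsto (fun z : ℂ => f z) (cocompact ℂ) (𝓝 (f ∞)) := by
      rw [← coclosedCompact_eq_cocompact]
      exact (f.continuous.tendsto _).comp OnePoint.tendsto_coe_infty
    refine h1.eventually_const_lt ?_
    rw [hf1 hinf]; norm_num
  obtain ⟨r, hr⟩ : ∃ r : ℝ, ∀ z : ℂ, r < ‖z‖ → 2 / 3 < f z := by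
    rw [← Metric.cobounded_eq_cocompact, ← comap_norm_atTop, eventually_comap] at hev
    obtain ⟨r, hr⟩ := eventually_atTop.1 hev
    exact ⟨r, fun z hz => hr _ hz.le z rfl⟩
  refine not_eventually_eq_sub hGc hG0 a (r := r + ‖a‖) fun z hz => hGB z (hr z ?_)
  have := norm_sub_le z a
  linarith

/-- The complement of a simply connected open subset of the sphere is connected. -/
theorem IsSimplyConnected.isPreconnected_compl {U : Set (OnePoint ℂ)} (hU : IsOpen U)
    (hsc : IsSimplyConnected U) : IsPreconnected Uᶜ := by
  rw [isPreconnected_iff_subset_of_fully_disjoint_closed hU.isClosed_compl]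
  intro u v hu hv huv hd
  by_contra! h
  obtain ⟨⟨a, haU, hau⟩, ⟨b, hbU, hbv⟩⟩ := And.imp not_subset.1 not_subset.1 h
  have hav : a ∈ v := (huv haU).resolve_left hau
  have hbu : b ∈ u := (huv hbU).resolve_right hbv
  obtain ⟨M, -, -, -, -, hM⟩ := exists_mobius b
  refine false_of_isSimplyConnected_of_separated (U := M '' U) (A := M '' (Uᶜ ∩ v))
    (B := M '' (Uᶜ ∩ u)) ((M.isOpen_image).2 hU) (M.isSimplyConnected_image.2 hsc)
    ((M.isClosed_image).2 (hU.isClosed_compl.inter hv))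
    ((M.isClosed_image).2 (hU.isClosed_compl.inter hu)) ?_ ?_ ⟨b, ⟨hbU, hbu⟩, hM⟩
    ⟨M a, a, ⟨haU, hav⟩, rfl⟩
  · rw [disjoint_image_iff M.injective]
    exact (hd.symm.mono inter_subset_right inter_subset_right)
  · rw [← image_compl_eq M.bijective, ← image_union, ← inter_union_distrib_left,
      inter_eq_left.2 (by rwa [union_comm])]

lemma isPreconnected_norm_gt {r : ℝ} (hr : 0 < r) : IsPreconnected {z : ℂ | r < ‖z‖} := by
  have h1 : {z : ℂ | r < ‖z‖} = Complex.exp '' (Complex.reLm ⁻¹' Ioi (Real.log r)) := by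
    ext z
    constructor
    · intro hz
      have hz' : r < ‖z‖ := hz
      have h0 : z ≠ 0 := norm_pos_iff.1 (hr.trans hz')
      refine ⟨Complex.log z, ?_, Complex.exp_log h0⟩
      change Real.log r < (Complex.log z).re
      rw [Complex.log_re]
      exact Real.log_lt_log hr hz'
    · rintro ⟨w, hw, rfl⟩
      change r < ‖Complex.exp w‖
      rw [Complex.norm_exp]
      exact (Real.log_lt_iff_lt_exp hr).1 hw
  rw [h1]
  exact ((convex_Ioi _).linear_preimage Complex.reLm).isPreconnected.image _
    Complex.continuous_exp.continuousOn

/-- Nonvanishing functions on the sphere have logarithms. -/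
lemma exists_log_sphere {f : OnePoint ℂ → ℂ} (hf : Continuous f) (h0 : ∀ s, f s ≠ 0) :
    ∃ v : OnePoint ℂ → ℂ, Continuous v ∧ ∀ s, Complex.exp (v s) = f s := by
  obtain ⟨H, hH, hexp⟩ := Complex.exists_continuousOn_eqOn_exp_comp isSimplyConnected_univ_complex
    isOpen_univ (g := fun z : ℂ => f z) (hf.comp OnePoint.continuous_coe).continuousOn
    (by rintro ⟨z, -, hz⟩; exact h0 z hz)
  have hH' : Continuous H := continuousOn_univ.1 hH
  have hexp' : ∀ z : ℂ, Complex.exp (H z) = f z := fun z => hexp (mem_univ z)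
  have hlim : Tendsto (fun z : ℂ => f z / f ∞) (cocompact ℂ) (𝓝 1) := by
    rw [← div_self (h0 ∞), ← coclosedCompact_eq_cocompact]
    exact ((hf.tendsto _).comp OnePoint.tendsto_coe_infty).div_const _
  have hev := hlim.eventually (Complex.isOpen_slitPlane.mem_nhds Complex.one_mem_slitPlane)
  obtain ⟨r, hr0, hr⟩ : ∃ r : ℝ, 0 < r ∧ ∀ z : ℂ, r < ‖z‖ → f z / f ∞ ∈ Complex.slitPlane := by
    rw [← Metric.cobounded_eq_cocompact, ← comap_norm_atTop, eventually_comap] at hev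
    obtain ⟨r, hr⟩ := eventually_atTop.1 hev
    exact ⟨|r| + 1, by positivity, fun z hz => hr _ (by linarith [le_abs_self r]) z rfl⟩
  -- Near `∞` the planar logarithm differs from a principal branch by a constant, which is therefore
  -- its limit at `∞`.
  let k : ℂ → ℂ := fun z => H z - Complex.log (f z / f ∞)
  have hfc : Continuous fun z : ℂ => f z := hf.comp OnePoint.continuous_coe
  have hk : ContinuousOn k {z : ℂ | r < ‖z‖} := by
    refine hH'.continuousOn.sub (ContinuousOn.clog ?_ fun z hz => hr z hz)
    exact (hfc.div_const _).continuousOn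
  have hkexp : ∀ z, Complex.exp (k z) = f ∞ := by
    intro z
    rw [Complex.exp_sub, hexp', Complex.exp_log (div_ne_zero (h0 _) (h0 _))]
    field_simp [h0 z, h0 ∞]
  obtain ⟨z₀, hz₀⟩ : ∃ z₀ : ℂ, r < ‖z₀‖ := ⟨(r + 1 : ℝ), by
    rw [Complex.norm_real, Real.norm_of_nonneg (by linarith)]; linarith⟩
  have hconst : ∀ z : ℂ, r < ‖z‖ → k z = k z₀ := fun z hz =>
    eq_of_exp_const (isPreconnected_norm_gt hr0) hk (fun a _ b _ => by rw [hkexp, hkexp]) hz hz₀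
  refine ⟨fun s => s.elim (k z₀) H, ?_, ?_⟩
  · rw [continuous_iff_continuousAt]
    intro s
    induction s using OnePoint.rec with
    | infty =>
      rw [OnePoint.continuousAt_infty', coclosedCompact_eq_cocompact]
      have h1 : Tendsto (fun z : ℂ => k z₀ + Complex.log (f z / f ∞)) (cocompact ℂ)
          (𝓝 (k z₀ + Complex.log 1)) :=
        tendsto_const_nhds.add (hlim.clog Complex.one_mem_slitPlane)
      rw [Complex.log_one, add_zero] at h1
      refine h1.congr' ?_
      filter_upwards [tendsto_norm_cocompact_atTop.eventually_gt_atTop r] with z hz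
      rw [← hconst z hz]
      simp [k]
    | coe z =>
      rw [OnePoint.continuousAt_coe]
      exact hH'.continuousAt
  · intro s
    induction s using OnePoint.rec with
    | infty => exact hkexp z₀
    | coe z => exact hexp' z

/-- Unicoherence of the sphere. -/
theorem isPreconnected_inter_of_union_eq_univ {A B : Set (OnePoint ℂ)} (hA : IsClosed A)
    (hB : IsClosed B) (hAc : IsPreconnected A) (hBc : IsPreconnected B) (hAB : A ∪ B = univ) :
    IsPreconnected (A ∩ B) := by
  rw [isPreconnected_iff_subset_of_fully_disjoint_closed (hA.inter hB)]
  intro P Q hP hQ hPQ hd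
  by_contra! h
  obtain ⟨⟨q, hqAB, hqP⟩, ⟨p, hpAB, hpQ⟩⟩ := And.imp not_subset.1 not_subset.1 h
  have hqQ : q ∈ Q := (hPQ hqAB).resolve_left hqP
  have hpP : p ∈ P := (hPQ hpAB).resolve_right hpQ
  obtain ⟨u, hu0, hu1, -⟩ := exists_continuous_zero_one_of_isClosed hP hQ hd
  let α : OnePoint ℂ → ℂ := fun s => Real.pi * Complex.I * (u s : ℂ)
  have hα : Continuous α := by fun_prop
  classical
  -- The two formulas agree on `A ∩ B`, where `α` is `0` or `πi`. For a logarithm `v` of `F`, `v -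
  -- α` is constant on `A` and `v + α` on `B`; comparing `p` with `q` forces `πi = 0`.
  let F : OnePoint ℂ → ℂ := fun s => if s ∈ A then Complex.exp (α s) else Complex.exp (-α s)
  have hFA : EqOn F (fun s => Complex.exp (α s)) A := fun s hs => by simp [F, hs]
  have hFB : EqOn F (fun s => Complex.exp (-α s)) B := by
    intro s hs
    by_cases hsA : s ∈ A
    · simp only [F, hsA, if_true]
      rcases hPQ ⟨hsA, hs⟩ with h | h
      · simp [α, hu0 h]
      · have : u s = 1 := hu1 h
        simp [α, this, Complex.exp_neg, Complex.exp_pi_mul_I]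
    · simp [F, hsA]
  have hF : Continuous F := by
    rw [← continuousOn_univ, ← hAB]
    refine ContinuousOn.union_of_isClosed ?_ ?_ hA hB
    · exact (ContinuousOn.congr (by fun_prop) hFA)
    · exact (ContinuousOn.congr (by fun_prop) hFB)
  obtain ⟨v, hv, hvF⟩ := exists_log_sphere hF (fun s => by
    simp only [F]; split_ifs <;> exact Complex.exp_ne_zero _)
  have h1 : v p - α p = v q - α q := by
    refine eq_of_exp_const (k := fun s => v s - α s) hAc (by fun_prop) ?_ hpAB.1 hqAB.1
    intro a ha b hb
    rw [Complex.exp_sub, Complex.exp_sub, hvF, hvF, hFA ha, hFA hb,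
      div_self (Complex.exp_ne_zero _), div_self (Complex.exp_ne_zero _)]
  have h2 : v p + α p = v q + α q := by
    refine eq_of_exp_const (k := fun s => v s + α s) hBc (by fun_prop) ?_ hpAB.2 hqAB.2
    intro a ha b hb
    rw [Complex.exp_add, Complex.exp_add, hvF, hvF, hFB ha, hFB hb, ← Complex.exp_add,
      ← Complex.exp_add]
    simp
  have hp : α p = 0 := by
    have : u p = 0 := hu0 hpP
    simp [α, this]
  have hq : α q = Real.pi * Complex.I := by
    have : u q = 1 := hu1 hqQ
    simp [α, this]
  rw [hp, hq] at h1 h2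
  have : (Real.pi : ℂ) * Complex.I = 0 := by linear_combination (h2 - h1) / (-2)
  simp [Real.pi_ne_zero] at this

end RationalDynamics

end

/-! ### Rational maps: lifts, fibres and total ramification -/

noncomputable section

namespace RationalDynamics

open Set Filter Topology Polynomial
open scoped OnePoint

/-- The homogenization of degree `d` of a polynomial. -/
def homEval (d : ℕ) (p : ℂ[X]) (x : ℂ × ℂ) : ℂ :=
  ∑ i ∈ Finset.range (d + 1), p.coeff i * x.1 ^ i * x.2 ^ (d - i)

lemma homEval_smul (d : ℕ) (p : ℂ[X]) (c : ℂ) (x : ℂ × ℂ) :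
    homEval d p (c • x) = c ^ d * homEval d p x := by
  rw [homEval, homEval, Finset.mul_sum]
  refine Finset.sum_congr rfl fun i hi => ?_
  have : i ≤ d := by rw [Finset.mem_range] at hi; lia
  rw [Prod.smul_fst, Prod.smul_snd, smul_eq_mul, smul_eq_mul, mul_pow, mul_pow,
    ← pow_mul_pow_sub c this]
  ring

lemma homEval_one {d : ℕ} {p : ℂ[X]} (h : p.natDegree ≤ d) (z : ℂ) :
    homEval d p (z, 1) = p.eval z := by
  rw [eval_eq_sum_range' (Nat.lt_succ_of_le h), homEval]
  simp

lemma homEval_zero (d : ℕ) (p : ℂ[X]) (u : ℂ) : homEval d p (u, 0) = p.coeff d * u ^ d := by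
  rw [homEval, Finset.sum_range_succ, Finset.sum_eq_zero, zero_add]
  · simp
  · intro i hi
    rw [Finset.mem_range] at hi
    simp [Nat.sub_ne_zero_of_lt hi]

lemma differentiable_homEval (d : ℕ) (p : ℂ[X]) : Differentiable ℂ (homEval d p) := by
  unfold homEval
  fun_prop

variable (R : RatFunc ℂ)

/-- The lift of a rational map to homogeneous coordinates. -/
def ratLift (x : ℂ × ℂ) : ℂ × ℂ :=
  (homEval (ratDegree R) R.num x, homEval (ratDegree R) R.denom x)

lemma natDegree_num_le : R.num.natDegree ≤ ratDegree R := le_max_left _ _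

lemma natDegree_denom_le : R.denom.natDegree ≤ ratDegree R := le_max_right _ _

lemma ratLift_smul (c : ℂ) (x : ℂ × ℂ) : ratLift R (c • x) = c ^ ratDegree R • ratLift R x := by
  ext <;> simp [ratLift, homEval_smul]

lemma ratLift_one (z : ℂ) : ratLift R (z, 1) = (R.num.eval z, R.denom.eval z) := by
  rw [ratLift, homEval_one (natDegree_num_le R), homEval_one (natDegree_denom_le R)]

lemma ratLift_infty : ratLift R (1, 0) =
    (R.num.coeff (ratDegree R), R.denom.coeff (ratDegree R)) := by
  simp [ratLift, homEval_zero]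

lemma ratLift_coords_ne_zero (s : OnePoint ℂ) : ratLift R (coords s) ≠ 0 := by
  induction s using OnePoint.rec with
  | infty =>
    rw [coords_infty, ratLift_infty, Ne, Prod.ext_iff]
    rintro ⟨h1, h2⟩
    have hd : R.denom.natDegree ≠ ratDegree R := by
      intro h
      change R.denom.coeff (ratDegree R) = 0 at h2
      rw [← h] at h2
      exact R.denom_ne_zero (leadingCoeff_eq_zero.1 h2)
    have hn : R.num.natDegree = ratDegree R := by
      rw [ratDegree] at hd ⊢
      lia
    have hlt : R.denom.natDegree < R.num.natDegree := by
      have := natDegree_denom_le R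
      lia
    change R.num.coeff (ratDegree R) = 0 at h1
    rw [← hn] at h1
    have h0 := leadingCoeff_eq_zero.1 h1
    rw [h0] at hlt
    simp at hlt
  | coe z =>
    rw [coords_coe, ratLift_one, Ne, Prod.ext_iff]
    rintro ⟨h1, h2⟩
    obtain ⟨a, b, hab⟩ := R.isCoprime_num_denom
    have := congrArg (eval z) hab
    simp only [eval_add, eval_mul, eval_one] at this
    change R.num.eval z = 0 at h1
    change R.denom.eval z = 0 at h2
    simp [h1, h2] at this

lemma ratLift_ne_zero {x : ℂ × ℂ} (hx : x ≠ 0) : ratLift R x ≠ 0 := by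
  obtain ⟨c, hc, h⟩ := exists_smul_eq_of_proj_eq (coords_ne_zero (proj x)) hx (proj_coords _)
  rw [h, ratLift_smul]
  exact smul_ne_zero (pow_ne_zero _ hc) (ratLift_coords_ne_zero R _)

lemma proj_ratLift_coords (s : OnePoint ℂ) : proj (ratLift R (coords s)) = ratMap R s := by
  induction s using OnePoint.rec with
  | infty =>
    rw [coords_infty, ratLift_infty]
    by_cases h : R.denom.natDegree < R.num.natDegree
    · have h1 : R.denom.coeff (ratDegree R) = 0 :=
        coeff_eq_zero_of_natDegree_lt (h.trans_le (natDegree_num_le R))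
      simp [proj, ratMap, h1, h]
    · have hd : ratDegree R = R.denom.natDegree := by rw [ratDegree]; lia
      rw [hd]
      simp [proj, ratMap, h, R.denom_ne_zero]
  | coe z =>
    rw [coords_coe, ratLift_one]
    simp [proj, ratMap]

lemma hasLift_ratMap : HasLift (ratMap R) (ratLift R) := by
  have h := HasLift.of_homogeneous (Φ := ratLift R)
    ((differentiable_homEval _ _).prodMk (differentiable_homEval _ _))
    (fun x hx => ratLift_ne_zero R hx) (ratLift_smul R)
  have h2 : (fun s => proj (ratLift R (coords s))) = ratMap R := funext (proj_ratLift_coords R)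
  rwa [h2] at h

lemma continuous_ratMap : Continuous (ratMap R) := (hasLift_ratMap R).continuous

/-- The polynomial whose roots are the finite preimages of `w`. -/
def fiberPoly (w : OnePoint ℂ) : ℂ[X] :=
  C (coords w).2 * R.num - C (coords w).1 * R.denom

lemma natDegree_fiberPoly_le (w : OnePoint ℂ) : (fiberPoly R w).natDegree ≤ ratDegree R :=
  (natDegree_sub_le _ _).trans (max_le ((natDegree_C_mul_le _ _).trans (natDegree_num_le R))
    ((natDegree_C_mul_le _ _).trans (natDegree_denom_le R)))

lemma ratMap_coe_eq_iff (z : ℂ) (w : OnePoint ℂ) :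
    ratMap R z = w ↔ (fiberPoly R w).eval z = 0 := by
  conv_lhs => rw [← proj_ratLift_coords, ← proj_coords w]
  rw [proj_eq_iff (ratLift_coords_ne_zero R _) (coords_ne_zero w), coords_coe, ratLift_one, fiberPoly]
  simp only [eval_sub, eval_mul, eval_C, sub_eq_zero]
  rw [mul_comm, mul_comm (R.denom.eval z)]

/-- The point `∞` lies in the fibre exactly when the fibre polynomial drops below degree `d`. -/
lemma ratMap_infty_eq_iff (w : OnePoint ℂ) :
    ratMap R ∞ = w ↔ (fiberPoly R w).coeff (ratDegree R) = 0 := by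
  conv_lhs => rw [← proj_ratLift_coords, ← proj_coords w]
  rw [proj_eq_iff (ratLift_coords_ne_zero R _) (coords_ne_zero w), coords_infty, ratLift_infty, fiberPoly]
  simp only [coeff_sub, coeff_C_mul, sub_eq_zero]
  rw [mul_comm, mul_comm (R.denom.coeff _)]

lemma surjective_ratMap (hR : 1 ≤ ratDegree R) : Function.Surjective (ratMap R) := by
  intro w
  by_cases h : (fiberPoly R w).natDegree = 0
  · refine ⟨∞, (ratMap_infty_eq_iff R w).2 (coeff_eq_zero_of_natDegree_lt (by lia))⟩
  · have : (fiberPoly R w).degree ≠ 0 := fun h' => h (natDegree_eq_of_degree_eq_some h')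
    obtain ⟨z, hz⟩ := IsAlgClosed.exists_root _ this
    exact ⟨z, (ratMap_coe_eq_iff R z w).2 hz⟩

/-- The fibre polynomial of a totally ramified value. -/
lemma fiberPoly_of_preimage_eq_singleton {w p : OnePoint ℂ} (h : ratMap R ⁻¹' {w} = {p}) :
    ∃ c : ℂ, ∀ z : ℂ, (fiberPoly R w).eval z =
      c * ((coords z).1 * (coords p).2 - (coords z).2 * (coords p).1) ^ ratDegree R := by
  have hz : ∀ z : ℂ, (fiberPoly R w).eval z = 0 ↔ (z : OnePoint ℂ) = p := fun z => by
    rw [← ratMap_coe_eq_iff, ← mem_singleton_iff (b := p), ← h]; rfl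
  have hinf : (fiberPoly R w).coeff (ratDegree R) = 0 ↔ ∞ = p := by
    rw [← ratMap_infty_eq_iff, ← mem_singleton_iff (b := p), ← h]; rfl
  induction p using OnePoint.rec with
  | infty =>
    have h0 : (fiberPoly R w).degree = 0 := by
      by_contra h0
      obtain ⟨z, hz'⟩ := IsAlgClosed.exists_root _ h0
      exact OnePoint.coe_ne_infty z ((hz z).1 hz')
    -- For `p = ∞` the bracket is the constant `-1`, whose power the sign undoes.
    refine ⟨(fiberPoly R w).coeff 0 * (-1) ^ ratDegree R, fun z => ?_⟩
    rw [eq_C_of_degree_eq_zero h0]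
    simp [coords, mul_assoc, ← mul_pow]
  | coe a =>
    have hne : (fiberPoly R w).coeff (ratDegree R) ≠ 0 := fun h' =>
      OnePoint.infty_ne_coe a (hinf.1 h')
    have hdeg : (fiberPoly R w).natDegree = ratDegree R :=
      le_antisymm (natDegree_fiberPoly_le R w) (le_natDegree_of_ne_zero hne)
    have hne0 : fiberPoly R w ≠ 0 := fun h' => hne (by rw [h', coeff_zero])
    have hsplit := IsAlgClosed.splits (fiberPoly R w)
    have hroots : (fiberPoly R w).roots = Multiset.replicate (ratDegree R) a := by
      rw [Multiset.eq_replicate]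
      refine ⟨by rw [← hdeg]; exact hsplit.natDegree_eq_card_roots.symm, fun b hb => ?_⟩
      rw [mem_roots hne0] at hb
      exact OnePoint.coe_injective ((hz b).1 hb)
    refine ⟨(fiberPoly R w).leadingCoeff, fun z => ?_⟩
    conv_lhs => rw [hsplit.eq_prod_roots, hroots]
    simp [coords]

/-- Injectivity would make every fibre polynomial through a finite `z` a `d`-th power, so its
derivative also vanishes there. Eliminating the coordinates of `w` shows that the Wronskian of
numerator and denominator is zero; coprimality then makes both constant. -/
lemma not_injective_ratMap (hR : 2 ≤ ratDegree R) : ¬ Function.Injective (ratMap R) := by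
  intro hinj
  have hW : ∀ z : ℂ, (derivative R.num * R.denom - R.num * derivative R.denom).eval z = 0 := by
    intro z
    set w := ratMap R z with hw
    have hpre : ratMap R ⁻¹' {w} = {(z : OnePoint ℂ)} := by
      ext s
      simp only [mem_preimage, mem_singleton_iff, hw]
      exact hinj.eq_iff
    obtain ⟨c, hc⟩ := fiberPoly_of_preimage_eq_singleton R hpre
    have hpoly : fiberPoly R w = C c * (X - C z) ^ ratDegree R := by
      refine Polynomial.funext fun x => ?_
      rw [hc]
      simp [coords]
    have h0 : (fiberPoly R w).eval z = 0 := (ratMap_coe_eq_iff R z w).1 rfl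
    have h1 : (derivative (fiberPoly R w)).eval z = 0 := by
      rw [hpoly]
      simp [derivative_pow, show ratDegree R - 1 ≠ 0 by lia]
    have h2 := coords_ne_zero w
    simp only [fiberPoly, eval_sub, eval_mul, eval_C, derivative_sub, derivative_mul,
      derivative_C, zero_mul, zero_add] at h0 h1
    simp only [eval_sub, eval_mul]
    set a := (coords w).1
    set b := (coords w).2
    have e1 : b * (R.num.derivative.eval z * R.denom.eval z
        - R.num.eval z * R.denom.derivative.eval z) = 0 := by
      linear_combination R.denom.eval z * h1 - R.denom.derivative.eval z * h0
    have e2 : a * (R.num.derivative.eval z * R.denom.eval z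
        - R.num.eval z * R.denom.derivative.eval z) = 0 := by
      linear_combination R.num.eval z * h1 - R.num.derivative.eval z * h0
    by_contra hne
    exact h2 (Prod.ext ((mul_eq_zero.1 e2).resolve_right hne)
      ((mul_eq_zero.1 e1).resolve_right hne))
  have hW0 : derivative R.num * R.denom = R.num * derivative R.denom := by
    rw [← sub_eq_zero]
    exact Polynomial.funext fun z => by rw [hW, eval_zero]
  have hcop := R.isCoprime_num_denom
  have h1 : derivative R.denom = 0 := by
    by_contra h
    have : R.denom ∣ derivative R.denom :=
      hcop.symm.dvd_of_dvd_mul_left (Dvd.intro_left _ hW0)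
    have h3 := degree_le_of_dvd this h
    exact absurd (degree_derivative_lt R.denom_ne_zero) (not_lt.2 h3)
  have h2 : derivative R.num = 0 := by
    rw [h1, mul_zero] at hW0
    exact (mul_eq_zero.1 hW0).resolve_right R.denom_ne_zero
  have h3 := derivative_eq_zero.1 h1
  have h4 := derivative_eq_zero.1 h2
  rw [ratDegree, h3, h4] at hR
  simp at hR

lemma hnorm_smul (c : ℂ) (x : ℂ × ℂ) : hnorm (c • x) = ‖c‖ * hnorm x := by
  conv_rhs => rw [hnorm, ← Real.sqrt_sq (norm_nonneg c), ← Real.sqrt_mul (by positivity)]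
  rw [hnorm]
  congr 1
  simp only [Prod.smul_fst, Prod.smul_snd, smul_eq_mul, norm_mul]
  ring

/-- Both sides are homogeneous of degree `d`, so a positive minimum of the quotient on the compact
unit sphere suffices. -/
lemma exists_pos_le_hnorm_ratLift : ∃ m : ℝ, 0 < m ∧ ∀ x : ℂ × ℂ, x ≠ 0 →
    m * hnorm x ^ ratDegree R ≤ hnorm (ratLift R x) := by
  have hcont : Continuous (ratLift R) := (hasLift_ratMap R).1.continuous
  have hne : (Metric.sphere (0 : ℂ × ℂ) 1).Nonempty := NormedSpace.sphere_nonempty.2 zero_le_one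
  have hne0 : ∀ x ∈ Metric.sphere (0 : ℂ × ℂ) 1, x ≠ 0 := fun x hx => by
    rintro rfl; simp at hx
  obtain ⟨x₀, hx₀, hmin⟩ := (isCompact_sphere (0 : ℂ × ℂ) 1).exists_isMinOn hne
    (f := fun x => hnorm (ratLift R x) / hnorm x ^ ratDegree R) (by
      refine ContinuousOn.div (continuous_hnorm.comp hcont).continuousOn
        (continuous_hnorm.pow _).continuousOn fun x hx => ?_
      exact pow_ne_zero _ (hnorm_pos (hne0 x hx)).ne')
  refine ⟨hnorm (ratLift R x₀) / hnorm x₀ ^ ratDegree R,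
    div_pos (hnorm_pos (ratLift_ne_zero R (hne0 _ hx₀))) (pow_pos (hnorm_pos (hne0 _ hx₀)) _),
    fun x hx => ?_⟩
  have hn : ‖x‖ ≠ 0 := norm_ne_zero_iff.2 hx
  have hn' : ((‖x‖ : ℝ) : ℂ) ≠ 0 := by exact_mod_cast hn
  let y : ℂ × ℂ := ((‖x‖ : ℝ) : ℂ)⁻¹ • x
  have hy : y ∈ Metric.sphere (0 : ℂ × ℂ) 1 := by
    rw [mem_sphere_zero_iff_norm, norm_smul, norm_inv, Complex.norm_real, norm_norm,
      inv_mul_cancel₀ hn]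
  have hxy : ((‖x‖ : ℝ) : ℂ) • y = x := smul_inv_smul₀ hn' x
  have h1 := hmin hy
  simp only [mem_ofPred_eq] at h1
  rw [le_div_iff₀ (pow_pos (hnorm_pos (hne0 _ hy)) _)] at h1
  clear_value y
  rw [← hxy, ratLift_smul, hnorm_smul, hnorm_smul, norm_pow, mul_pow, mul_left_comm]
  exact mul_le_mul_of_nonneg_left h1 (by positivity)

/-- Near a totally ramified point, a rational map does not increase the chordal distance. -/
lemma exists_dist_ratMap_le (hR : 2 ≤ ratDegree R) {w p : OnePoint ℂ}
    (h : ratMap R ⁻¹' {w} = {p}) :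
    ∃ ρ : ℝ, 0 < ρ ∧ ∀ s, dist s p < ρ → dist (ratMap R s) w ≤ dist s p := by
  obtain ⟨c, hc⟩ := fiberPoly_of_preimage_eq_singleton R h
  obtain ⟨m, hm, hmle⟩ := exists_pos_le_hnorm_ratLift R
  have hp := hnorm_pos (coords_ne_zero p)
  have hw := hnorm_pos (coords_ne_zero w)
  obtain ⟨K, hK, hbound⟩ : ∃ K : ℝ, 0 ≤ K ∧ ∀ z : ℂ,
      dist (ratMap R z) w ≤ K * dist (z : OnePoint ℂ) p ^ ratDegree R := by
    refine ⟨2 * ‖c‖ * hnorm (coords p) ^ ratDegree R / (m * hnorm (coords w) * 2 ^ ratDegree R),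
      by positivity, fun z => ?_⟩
    have h1 : dist (ratMap R z) w = 2 * ‖(fiberPoly R w).eval z‖ /
        (hnorm (ratLift R (coords z)) * hnorm (coords w)) := by
      conv_lhs => rw [← proj_ratLift_coords, ← proj_coords w,
        dist_proj (ratLift_coords_ne_zero R _) (coords_ne_zero w)]
      congr 3
      rw [coords_coe, ratLift_one, fiberPoly]
      simp only [eval_sub, eval_mul, eval_C]
      ring
    have h2 : dist (z : OnePoint ℂ) p = 2 * ‖(coords z).1 * (coords p).2 -
        (coords z).2 * (coords p).1‖ / (hnorm (coords z) * hnorm (coords p)) := by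
      conv_lhs => rw [← proj_coords (z : OnePoint ℂ), ← proj_coords p,
        dist_proj (coords_ne_zero _) (coords_ne_zero p)]
    have hz := hnorm_pos (coords_ne_zero (z : OnePoint ℂ))
    rw [h1, h2, hc, norm_mul, norm_pow, div_pow, mul_pow, mul_pow]
    have h3 := hmle _ (coords_ne_zero (z : OnePoint ℂ))
    set q := ‖(coords z).1 * (coords p).2 - (coords z).2 * (coords p).1‖
    have h4 : 2 * ‖c‖ * hnorm (coords p) ^ ratDegree R / (m * hnorm (coords w) * 2 ^ ratDegree R) *
        (2 ^ ratDegree R * q ^ ratDegree R /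
          (hnorm (coords z) ^ ratDegree R * hnorm (coords p) ^ ratDegree R)) =
        2 * (‖c‖ * q ^ ratDegree R) /
          (m * hnorm (coords z) ^ ratDegree R * hnorm (coords w)) := by
      field_simp
    rw [h4]
    gcongr
  have hbound' : ∀ s, dist (ratMap R s) w ≤ K * dist s p ^ ratDegree R := by
    have hcl : IsClosed {s | dist (ratMap R s) w ≤ K * dist s p ^ ratDegree R} := by
      have := continuous_ratMap R
      exact isClosed_le (by fun_prop) (by fun_prop)
    intro s
    have := (OnePoint.denseRange_coe (X := ℂ)).closure_eq ▸ mem_univ s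
    exact hcl.closure_subset_iff.2 (by rintro _ ⟨z, rfl⟩; exact hbound z) this
  -- Below this radius `K * dist ≤ 1`, and `d ≥ 2` leaves a factor `dist` to spare.
  refine ⟨min 1 (1 / (K + 1)), by positivity, fun s hs => (hbound' s).trans ?_⟩
  have h1 := hs.trans_le (min_le_left _ _)
  have h2 := (hs.trans_le (min_le_right _ _)).le
  rw [le_div_iff₀ (by positivity)] at h2
  have h0 : 0 ≤ dist s p := dist_nonneg
  have h3 : dist s p ^ ratDegree R ≤ dist s p ^ 2 := pow_le_pow_of_le_one h0 h1.le hR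
  calc K * dist s p ^ ratDegree R ≤ K * dist s p ^ 2 := by gcongr
    _ = (dist s p * K) * dist s p := by ring
    _ ≤ 1 * dist s p := by gcongr; linarith
    _ = dist s p := one_mul _

end RationalDynamics

end

/-! ### Two cases of Montel's theorem -/

noncomputable section

namespace RationalDynamics

open Set Filter Topology
open scoped OnePoint

section Equicontinuity

variable {ι : Type*}

/-- Each map sends the ball into the closed ball of radius `2 * C` about its value at `z₀`, so the
Schwarz lemma gives a common Lipschitz bound at `z₀`. -/
lemma equicontinuousAt_of_norm_le {k : ι → ℂ → ℂ} {z₀ : ℂ} {r C : ℝ} (hr : 0 < r)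
    (hk : ∀ i, DifferentiableOn ℂ (k i) (Metric.ball z₀ r))
    (hC : ∀ i, ∀ z ∈ Metric.ball z₀ r, ‖k i z‖ ≤ C) : EquicontinuousAt k z₀ := by
  refine Metric.equicontinuousAt_of_continuity_modulus (fun z => 2 * C / r * dist z z₀) ?_ k ?_
  · have : Continuous fun z : ℂ => 2 * C / r * dist z z₀ := by fun_prop
    simpa using this.tendsto z₀
  · filter_upwards [Metric.ball_mem_nhds z₀ hr] with z hz i
    rw [dist_comm]
    refine Complex.dist_le_div_mul_dist_of_mapsTo_ball (hk i) (fun w hw => ?_) hz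
    rw [Metric.mem_closedBall, dist_eq_norm]
    linarith [norm_sub_le (k i w) (k i z₀), hC i w hw, hC i z₀ (Metric.mem_ball_self hr)]

lemma equicontinuousAt_of_factor {X : Type*} [PseudoMetricSpace X] {g : ι → ℂ → X}
    {k : ι → ℂ → ℂ} {T : ℂ → X} (hT : Continuous T) {z₀ : ℂ} {r C : ℝ} (hr : 0 < r)
    (hk : ∀ i, DifferentiableOn ℂ (k i) (Metric.ball z₀ r))
    (hC : ∀ i, ∀ z ∈ Metric.ball z₀ r, ‖k i z‖ ≤ C)
    (hg : ∀ i, ∀ z ∈ Metric.ball z₀ r, g i z = T (k i z)) : EquicontinuousAt g z₀ := by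
  have hu := (isCompact_closedBall (0 : ℂ) C).uniformContinuousOn_of_continuous hT.continuousOn
  rw [Metric.uniformContinuousOn_iff] at hu
  rw [Metric.equicontinuousAt_iff]
  intro ε hε
  obtain ⟨δ, hδ, hd⟩ := hu ε hε
  obtain ⟨η, hη, he⟩ := Metric.equicontinuousAt_iff.1 (equicontinuousAt_of_norm_le hr hk hC) δ hδ
  refine ⟨min η r, lt_min hη hr, fun z hz i => ?_⟩
  have hzr : z ∈ Metric.ball z₀ r := hz.trans_le (min_le_right _ _)
  have h0 := Metric.mem_ball_self (x := z₀) hr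
  rw [hg i _ hzr, hg i _ h0]
  exact hd _ (by simpa using hC i _ h0) _ (by simpa using hC i _ hzr)
    (he z (hz.trans_le (min_le_left _ _)) i)

lemma equicontinuousAt_of_chart {X : Type*} [UniformSpace X] {f : ι → OnePoint ℂ → X}
    (N : OnePoint ℂ ≃ₜ OnePoint ℂ) {x : OnePoint ℂ} {z₀ : ℂ} (hz : N x = z₀)
    (h : EquicontinuousAt (fun i (z : ℂ) => f i (N.symm z)) z₀) : EquicontinuousAt f x := by
  intro U hU
  have h1 : ∀ᶠ s in 𝓝 (N x), ∀ i, (f i x, f i (N.symm s)) ∈ U := by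
    rw [hz, OnePoint.nhds_coe_eq, eventually_map]
    simpa only [← hz, Homeomorph.symm_apply_apply] using h U hU
  simpa using N.continuous.continuousAt.eventually h1

/-- The part of Montel's theorem where the maps omit a common open set. -/
lemma equicontinuousAt_of_notMem_nhds {f : ι → OnePoint ℂ → OnePoint ℂ} {Φ : ι → ℂ × ℂ → ℂ × ℂ}
    (hf : ∀ i, HasLift (f i) (Φ i)) {V W : Set (OnePoint ℂ)} {x q : OnePoint ℂ} (hV : V ∈ 𝓝 x)
    (hW : W ∈ 𝓝 q) (h : ∀ i, ∀ s ∈ V, f i s ∉ W) : EquicontinuousAt f x := by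
  -- Sending `q` to `∞` turns the omitted neighbourhood into a bound on the maps; the chart `N`
  -- below makes `x` finite.
  obtain ⟨M, ΦM, -, hM, -, hMq⟩ := exists_mobius q
  obtain ⟨e, he⟩ := exists_ne x
  obtain ⟨N, -, ΨN, -, hN, hNe⟩ := exists_mobius e
  have hNx : N x ≠ ∞ := fun hx => he (N.injective (hNe.trans hx.symm))
  obtain ⟨z₀, hz₀⟩ : ∃ z₀ : ℂ, N x = z₀ := by
    lift N x to ℂ using hNx with z₀
    exact ⟨z₀, rfl⟩
  refine equicontinuousAt_of_chart N hz₀ ?_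
  have hMW : ∀ᶠ s in 𝓝 ∞, M.symm s ∈ W := by
    refine M.symm.continuous.continuousAt.eventually ?_
    rwa [← hMq, M.symm_apply_apply]
  obtain ⟨C, hC⟩ : ∃ C : ℝ, ∀ z : ℂ, M.symm z ∉ W → ‖z‖ ≤ C := by
    have h1 : ∀ᶠ z : ℂ in cocompact ℂ, M.symm z ∈ W := by
      rw [← coclosedCompact_eq_cocompact]
      exact OnePoint.tendsto_coe_infty.eventually hMW
    rw [← Metric.cobounded_eq_cocompact, ← comap_norm_atTop, eventually_comap] at h1
    obtain ⟨C, hC⟩ := eventually_atTop.1 h1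
    exact ⟨C, fun z hz => le_of_not_ge fun hc => hz (hC _ hc z rfl)⟩
  have hVz : ∀ᶠ z : ℂ in 𝓝 z₀, N.symm z ∈ V := by
    have : ContinuousAt (fun z : ℂ => N.symm z) z₀ :=
      (N.symm.continuous.comp OnePoint.continuous_coe).continuousAt
    refine this.eventually ?_
    change V ∈ 𝓝 (N.symm z₀)
    rwa [← hz₀, N.symm_apply_apply]
  obtain ⟨r, hr, hball⟩ := Metric.eventually_nhds_iff_ball.1 hVz
  have hΓ := fun i => (hM.comp (hf i)).comp hN
  set Γ : ι → ℂ × ℂ → ℂ × ℂ := fun i => (ΦM ∘ Φ i) ∘ ΨN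
  have hg : ∀ i (z : ℂ), proj (Γ i (z, 1)) = M (f i (N.symm z)) := fun i z => by
    rw [(hΓ i).proj_eq _ (by simp), proj_one]
    rfl
  have hne : ∀ i, ∀ z ∈ Metric.ball z₀ r, (Γ i (z, 1)).2 ≠ 0 := by
    intro i z hz h0
    have h1 : M (f i (N.symm z)) = ∞ := by rw [← hg, proj, if_pos h0]
    have h2 : f i (N.symm z) = q := M.injective (h1.trans hMq.symm)
    exact h i _ (hball z hz) (h2 ▸ mem_of_mem_nhds hW)
  have hk : ∀ i, ∀ z ∈ Metric.ball z₀ r,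
      f i (N.symm z) = M.symm (((Γ i (z, 1)).1 / (Γ i (z, 1)).2 : ℂ)) := by
    intro i z hz
    rw [← proj_of_ne (hne i z hz), hg, M.symm_apply_apply]
  refine equicontinuousAt_of_factor (T := fun z : ℂ => M.symm z)
    (k := fun i z => (Γ i (z, 1)).1 / (Γ i (z, 1)).2)
    (M.symm.continuous.comp OnePoint.continuous_coe) hr (fun i => ?_) (fun i z hz => ?_) hk
    (C := C)
  · have h1 : Differentiable ℂ fun z : ℂ => Γ i (z, 1) :=
      (hΓ i).differentiable.comp (differentiable_id.prodMk (differentiable_const 1))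
    exact h1.fst.differentiableOn.div h1.snd.differentiableOn (hne i)
  · exact hC _ (by rw [← hk i z hz]; exact h i _ (hball z hz))

/-- Koebe's square-root trick: a branch `h` of the root of `z - b` never takes both a value and its
negative. Its image contains a disc about `h x`, so it misses the opposite disc about `-h x`. -/
lemma exists_sqrt_branch {Ω : Set ℂ} (hΩ : IsOpen Ω) (hsc : IsSimplyConnected Ω) {b : ℂ}
    (hb : b ∉ Ω) : ∃ (h : ℂ → ℂ) (a : ℂ) (ε : ℝ), 0 < ε ∧ DifferentiableOn ℂ h Ω ∧
      (∀ z ∈ Ω, h z ^ 2 = z - b) ∧ ∀ z ∈ Ω, ε < ‖h z - a‖ := by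
  obtain ⟨h, hc, hsq⟩ := Complex.exists_continuousOn_pow_eq (g := fun z => z - b) hsc hΩ
    (by fun_prop) (by rintro ⟨z, hz, h0⟩; exact hb (sub_eq_zero.1 h0 ▸ hz)) two_ne_zero
  have h0 : ∀ z ∈ Ω, h z ≠ 0 := fun z hz hz0 => by
    have := hsq z
    rw [hz0, zero_pow two_ne_zero, eq_comm, sub_eq_zero] at this
    exact hb (this ▸ hz)
  have hd : ∀ z ∈ Ω, HasStrictDerivAt h (2 * h z)⁻¹ z := by
    intro z hz
    refine HasStrictDerivAt.of_local_left_inverse (f := fun w => w ^ 2 + b)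
      (hc.continuousAt (hΩ.mem_nhds hz)) ?_ (by simpa using h0 z hz) (.of_forall fun w => ?_)
    · simpa using (hasStrictDerivAt_pow 2 (h z)).add_const b
    · simp [hsq]
  obtain ⟨x, hx⟩ := hsc.nonempty
  have himg : h '' Ω ∈ 𝓝 (h x) := by
    rw [← (hd x hx).map_nhds_eq (by simpa using h0 x hx)]
    exact image_mem_map (hΩ.mem_nhds hx)
  obtain ⟨ε, hε, hball⟩ := Metric.nhds_basis_closedBall.mem_iff.1 himg
  refine ⟨h, -h x, ε, hε, fun z hz => (hd z hz).hasDerivAt.differentiableAt.differentiableWithinAt,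
    fun z _ => hsq z, fun z hz => lt_of_not_ge fun hle => ?_⟩
  obtain ⟨w, hw, hwz⟩ := hball (show -h z ∈ Metric.closedBall (h x) ε by
    rw [Metric.mem_closedBall, dist_eq_norm,
      show -h z - h x = -(h z - -h x) by ring, norm_neg]
    exact hle)
  have hzw : w = z := by
    have h1 := hsq w
    rw [hwz, neg_sq, hsq z] at h1
    exact (sub_left_injective h1).symm
  subst hzw
  exact h0 w hw (by linear_combination hwz / 2)

/-- The part of Montel's theorem where the maps leave invariant a simply connected domain whose
complement has at least two points. -/
lemma equicontinuousAt_of_mapsTo {f : ι → OnePoint ℂ → OnePoint ℂ} {Φ : ι → ℂ × ℂ → ℂ × ℂ}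
    (hf : ∀ i, HasLift (f i) (Φ i)) {U : Set (OnePoint ℂ)} (hU : IsOpen U) (hUc : IsConnected U)
    (hE : IsPreconnected Uᶜ) {p q : OnePoint ℂ} (hp : p ∉ U) (hq : q ∉ U) (hpq : p ≠ q)
    (hmaps : ∀ i, MapsTo (f i) U U) {x : OnePoint ℂ} (hx : x ∈ U) : EquicontinuousAt f x := by
  obtain ⟨M, ΦM, ΨM, hM, hM', hMp⟩ := exists_mobius p
  have hfin : ∀ s, s ≠ p → ∃ z : ℂ, M s = z := fun s hs => by
    have : M s ≠ ∞ := fun hx => hs (M.injective (hx.trans hMp.symm))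
    lift M s to ℂ using this with z₀
    exact ⟨z₀, rfl⟩
  obtain ⟨z₀, hz₀⟩ := hfin x (fun h => hp (h ▸ hx))
  obtain ⟨b, hb⟩ := hfin q hpq.symm
  set c : ℂ → OnePoint ℂ := fun z => M.symm z with hcdef
  have hcc : Continuous c := M.symm.continuous.comp OnePoint.continuous_coe
  set Ω : Set ℂ := c ⁻¹' U with hΩdef
  have hΩ : IsOpen Ω := hU.preimage hcc
  have himg : ((↑) : ℂ → OnePoint ℂ) '' Ω = M '' U := by
    have h1 : ∞ ∉ M '' U := by
      rintro ⟨s, hs, hs'⟩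
      exact hp (M.injective (hs'.trans hMp.symm) ▸ hs)
    rw [← image_preimage_coe_of_infty_notMem h1, M.image_eq_preimage_symm]
    rfl
  have hΩc : IsConnected Ω := by
    have h1 : IsConnected (((↑) : ℂ → OnePoint ℂ) '' Ω) :=
      himg ▸ hUc.image _ M.continuous.continuousOn
    refine ⟨h1.1.of_image, ?_⟩
    exact (OnePoint.isOpenEmbedding_coe.isInducing.isPreconnected_image).1 h1.2
  have hsc : IsSimplyConnected Ω := by
    refine isSimplyConnected_of_isPreconnected_compl_image hΩ hΩc ?_
    rw [himg, ← image_compl_eq M.bijective]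
    exact hE.image _ M.continuous.continuousOn
  have hbΩ : b ∉ Ω := by
    rw [hΩdef, mem_preimage, hcdef]
    simpa only [← hb, M.symm_apply_apply] using hq
  have hz₀Ω : z₀ ∈ Ω := by
    rw [hΩdef, mem_preimage, hcdef]
    simpa only [← hz₀, M.symm_apply_apply] using hx
  obtain ⟨h, a, ε, hε, hd, hsq, ha⟩ := exists_sqrt_branch hΩ hsc hbΩ
  obtain ⟨r, hr, hball⟩ := Metric.isOpen_iff.1 hΩ z₀ hz₀Ω
  have hΓ := fun i => (hM.comp (hf i)).comp hM'
  set Γ : ι → ℂ × ℂ → ℂ × ℂ := fun i => (ΦM ∘ Φ i) ∘ ΨM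
  have hg : ∀ i (z : ℂ), proj (Γ i (z, 1)) = M (f i (c z)) := fun i z => by
    rw [(hΓ i).proj_eq _ (by simp), proj_one]
    rfl
  have hne : ∀ i, ∀ z ∈ Ω, (Γ i (z, 1)).2 ≠ 0 := by
    intro i z hz h0
    have h1 : M (f i (c z)) = ∞ := by rw [← hg, proj, if_pos h0]
    have h2 : f i (c z) = p := M.injective (h1.trans hMp.symm)
    exact hp (h2 ▸ hmaps i hz)
  set F : ι → ℂ → ℂ := fun i z => (Γ i (z, 1)).1 / (Γ i (z, 1)).2
  have hF : ∀ i, ∀ z ∈ Ω, f i (c z) = c (F i z) := by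
    intro i z hz
    rw [hcdef]
    simp only [F]
    rw [← proj_of_ne (hne i z hz), hg, M.symm_apply_apply]
  have hFΩ : ∀ i, MapsTo (F i) Ω Ω := fun i z hz => by
    rw [hΩdef, mem_preimage, ← hF i z hz]
    exact hmaps i hz
  have hFd : ∀ i, DifferentiableOn ℂ (F i) Ω := fun i => by
    have h1 : Differentiable ℂ fun z : ℂ => Γ i (z, 1) :=
      (hΓ i).differentiable.comp (differentiable_id.prodMk (differentiable_const 1))
    exact h1.fst.differentiableOn.div h1.snd.differentiableOn (hne i)
  have hha : ∀ z ∈ Ω, h z - a ≠ 0 := fun z hz => norm_pos_iff.1 (hε.trans (ha z hz))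
  have hkd : DifferentiableOn ℂ (fun z => (h z - a)⁻¹) Ω := (hd.sub_const a).inv hha
  refine equicontinuousAt_of_chart M hz₀ ?_
  -- The bounded coordinate is `k = 1 / (h - a)`. Inverting, `h = a + 1 / k` and `z = h² + b`;
  -- clearing `k²` gives homogeneous coordinates, so `T` is continuous at `k = 0` as well.
  refine equicontinuousAt_of_factor
    (T := fun k : ℂ => M.symm (proj ((1 + a * k) ^ 2 + b * k ^ 2, k ^ 2)))
    (k := fun i z => (h (F i z) - a)⁻¹) ?_ hr (fun i => ?_) (fun i z hz => ?_) (fun i z hz => ?_)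
    (C := ε⁻¹)
  · refine M.symm.continuous.comp (continuousOn_proj.comp_continuous (by fun_prop) fun k hk => ?_)
    rw [mem_singleton_iff, Prod.mk_eq_zero] at hk
    obtain ⟨h1, h2⟩ := hk
    rw [sq_eq_zero_iff] at h2
    simp [h2] at h1
  · exact (hkd.comp (hFd i) (hFΩ i)).mono hball
  · rw [norm_inv]
    exact inv_anti₀ hε (ha _ (hFΩ i (hball hz))).le
  · have hw := hFΩ i (hball hz)
    change f i (c z) = _
    rw [hF i z (hball hz)]
    change M.symm _ = M.symm _
    congr 1
    generalize F i z = w at hw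
    have h1 := hha w hw
    rw [proj_of_ne (by simpa using h1)]
    congr 1
    field_simp
    linear_combination -hsq w hw
end Equicontinuity

end RationalDynamics

end

/-! ### Normality, the Fatou set and nonemptiness of the Julia set -/

noncomputable section

namespace RationalDynamics

open Set Filter Topology
open scoped OnePoint

lemma convergesOnCompacts_of_tendstoUniformlyOn {f : ℕ → OnePoint ℂ → OnePoint ℂ}
    {g : OnePoint ℂ → OnePoint ℂ} {U : Set (OnePoint ℂ)} (h : TendstoUniformlyOn f g atTop U) :
    ConvergesOnCompacts f g U := by
  intro K _ hKU ε hε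
  obtain ⟨N, hN⟩ := eventually_atTop.1 (Metric.tendstoUniformlyOn_iff.1 h ε hε)
  refine ⟨N, fun n hn z hz => ?_⟩
  rw [chordalDist_eq_dist, dist_comm]
  exact hN n hn z (hKU hz)

lemma ConvergesOnCompacts.tendstoUniformlyOn {f : ℕ → OnePoint ℂ → OnePoint ℂ}
    {g : OnePoint ℂ → OnePoint ℂ} {U K : Set (OnePoint ℂ)} (h : ConvergesOnCompacts f g U)
    (hK : IsCompact K) (hKU : K ⊆ U) : TendstoUniformlyOn f g atTop K := by
  rw [Metric.tendstoUniformlyOn_iff]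
  intro ε hε
  obtain ⟨N, hN⟩ := h K hK hKU ε hε
  filter_upwards [eventually_ge_atTop N] with n hn z hz
  rw [dist_comm, ← chordalDist_eq_dist]
  exact hN n hn z hz

/-- The Arzelà–Ascoli theorem for sequences of self-maps of the sphere. -/
lemma exists_tendstoUniformlyOn_of_equicontinuousAt {f : ℕ → OnePoint ℂ → OnePoint ℂ}
    {K : Set (OnePoint ℂ)} (hK : IsCompact K) (h : ∀ x ∈ K, EquicontinuousAt f x) :
    ∃ φ : ℕ → ℕ, StrictMono φ ∧ ∃ g, TendstoUniformlyOn (fun n => f (φ n)) g atTop K := by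
  have := isCompact_iff_compactSpace.1 hK
  have hcont : ∀ n, Continuous fun y : K => f n y := fun n =>
    continuous_iff_continuousAt.2 fun y =>
      ((h y y.2).continuousAt n).comp continuousAt_subtype_val
  let B : ℕ → BoundedContinuousFunction K (OnePoint ℂ) := fun n =>
    BoundedContinuousFunction.mkOfCompact ⟨_, hcont n⟩
  have hcomp : IsCompact (closure (range B)) := by
    refine BoundedContinuousFunction.arzela_ascoli univ isCompact_univ _ (fun _ _ _ => mem_univ _)
      fun y U hU => ?_
    filter_upwards [continuousAt_subtype_val.eventually (h y y.2 U hU)] with z hz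
    rintro ⟨_, n, rfl⟩
    exact hz n
  obtain ⟨a, -, φ, hφ, ha⟩ := hcomp.tendsto_subseq fun n => subset_closure (mem_range_self (f := B) n)
  refine ⟨φ, hφ, fun s => open Classical in if hs : s ∈ K then a ⟨s, hs⟩ else s, ?_⟩
  rw [BoundedContinuousFunction.tendsto_iff_tendstoUniformly] at ha
  rw [tendstoUniformlyOn_iff_tendstoUniformly_comp_coe]
  have h1 : (fun s => open Classical in if hs : s ∈ K then a ⟨s, hs⟩ else s) ∘ Subtype.val = a := by
    funext y
    simp
  rw [h1]
  exact ha

lemma exists_tendstoUniformlyOn_union {f : ℕ → OnePoint ℂ → OnePoint ℂ}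
    {s t : Set (OnePoint ℂ)} {g₁ g₂ : OnePoint ℂ → OnePoint ℂ}
    (h₁ : TendstoUniformlyOn f g₁ atTop s) (h₂ : TendstoUniformlyOn f g₂ atTop t) :
    ∃ g, TendstoUniformlyOn f g atTop (s ∪ t) := by
  classical
  refine ⟨s.piecewise g₁ g₂, fun u hu => ?_⟩
  filter_upwards [h₁ u hu, h₂ u hu] with n h1 h2 x hx
  by_cases hs : x ∈ s
  · rw [piecewise_eq_of_mem _ _ _ hs]
    exact h1 x hs
  · rw [piecewise_eq_of_notMem _ _ _ hs]
    exact h2 x (hx.resolve_left hs)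

variable (R : RatFunc ℂ)

lemma isOpen_fatouSet : IsOpen (fatouSet R) := by
  rw [isOpen_iff_mem_nhds]
  rintro x ⟨U, hU, hx, h⟩
  exact mem_of_superset (hU.mem_nhds hx) fun y hy => ⟨U, hU, hy, h⟩

lemma EquicontinuousAt.comp_seq {ι κ X Y : Type*} [TopologicalSpace X] [UniformSpace Y]
    {f : ι → X → Y} {x : X} (h : EquicontinuousAt f x) (s : κ → ι) :
    EquicontinuousAt (fun k => f (s k)) x := fun U hU =>
  (h U hU).mono fun _ hy k => hy (s k)

lemma mem_fatouSet_of_equicontinuousAt {x : OnePoint ℂ}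
    (h : ∀ᶠ y in 𝓝 x, EquicontinuousAt (fun n : ℕ => (ratMap R)^[n]) y) : x ∈ fatouSet R := by
  obtain ⟨K, hK, hKs, hKc⟩ := local_compact_nhds h
  refine ⟨interior K, isOpen_interior, mem_interior_iff_mem_nhds.2 hK, fun s => ?_⟩
  obtain ⟨φ, hφ, g, hg⟩ := exists_tendstoUniformlyOn_of_equicontinuousAt hKc
    fun y hy => EquicontinuousAt.comp_seq (hKs hy) s
  exact ⟨φ, hφ, g, convergesOnCompacts_of_tendstoUniformlyOn (hg.mono interior_subset)⟩

/-- Division by `m` writes every iterate as one of the finitely many uniformly continuous `T^[r]`,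
`r < m`, after an iterate of `T^[m]`. -/
lemma equicontinuousAt_iterate_of_iterate_mul {X : Type*} [UniformSpace X] [CompactSpace X]
    {T : X → X} (hT : Continuous T) {m : ℕ} (hm : 0 < m) {x : X}
    (h : EquicontinuousAt (fun n : ℕ => T^[m * n]) x) :
    EquicontinuousAt (fun n : ℕ => T^[n]) x := by
  intro U hU
  have h1 : ∀ r ∈ Finset.range m, ∀ᶠ y in 𝓝 x, ∀ n : ℕ,
      (T^[r] (T^[m * n] x), T^[r] (T^[m * n] y)) ∈ U := fun r _ =>
    h _ (CompactSpace.uniformContinuous_of_continuous (hT.iterate r) hU)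
  filter_upwards [(eventually_all_finset _).2 h1] with y hy n
  have h2 := hy (n % m) (Finset.mem_range.2 (Nat.mod_lt n hm)) (n / m)
  rwa [← Function.iterate_add_apply, ← Function.iterate_add_apply, Nat.mod_add_div] at h2

lemma mem_fatouSet_of_iterate_mul {m : ℕ} (hm : 0 < m) {x : OnePoint ℂ}
    (h : ∀ᶠ y in 𝓝 x, EquicontinuousAt (fun n : ℕ => (ratMap R)^[m * n]) y) : x ∈ fatouSet R :=
  mem_fatouSet_of_equicontinuousAt R <| h.mono fun _ hy =>
    equicontinuousAt_iterate_of_iterate_mul (continuous_ratMap R) hm hy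

lemma mem_fatouSet_of_notMem_nhds {x q : OnePoint ℂ} {V W : Set (OnePoint ℂ)} (hV : IsOpen V)
    (hx : x ∈ V) (hW : W ∈ 𝓝 q) (h : ∀ n : ℕ, ∀ s ∈ V, (ratMap R)^[n] s ∉ W) :
    x ∈ fatouSet R :=
  mem_fatouSet_of_equicontinuousAt R <| (hV.eventually_mem hx).mono fun _ hy =>
    equicontinuousAt_of_notMem_nhds (fun n => (hasLift_ratMap R).iterate n) (hV.mem_nhds hy) hW h

/-- If the Fatou set is the whole sphere, then the iterates are normal on the sphere. -/
lemma exists_tendstoUniformly_of_fatouSet_eq_univ (h : fatouSet R = univ) (s : ℕ → ℕ) :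
    ∃ φ : ℕ → ℕ, StrictMono φ ∧ ∃ g, TendstoUniformly (fun n => (ratMap R)^[s (φ n)]) g atTop := by
  suffices H : ∀ s : ℕ → ℕ, ∃ φ : ℕ → ℕ, StrictMono φ ∧
      ∃ g, TendstoUniformlyOn (fun n => (ratMap R)^[s (φ n)]) g atTop univ by
    simpa only [tendstoUniformlyOn_univ] using H s
  refine (isCompact_univ (X := OnePoint ℂ)).induction_on
    (p := fun A => ∀ s : ℕ → ℕ, ∃ φ : ℕ → ℕ, StrictMono φ ∧
      ∃ g, TendstoUniformlyOn (fun n => (ratMap R)^[s (φ n)]) g atTop A)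
    (fun s => ⟨_, strictMono_id, _root_.id, tendstoUniformlyOn_empty⟩)
    (fun A B hAB hB s => ?_) (fun A B hA hB s => ?_) (fun x _ => ?_)
  · obtain ⟨φ, hφ, g, hg⟩ := hB s
    exact ⟨φ, hφ, g, hg.mono hAB⟩
  · obtain ⟨φ, hφ, g₁, hg₁⟩ := hA s
    obtain ⟨ψ, hψ, g₂, hg₂⟩ := hB (s ∘ φ)
    have h1 : TendstoUniformlyOn (fun n => (ratMap R)^[s (φ (ψ n))]) g₁ atTop A := fun u hu =>
      hψ.tendsto_atTop.eventually (hg₁ u hu)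
    obtain ⟨g, hg⟩ := exists_tendstoUniformlyOn_union h1 hg₂
    exact ⟨φ ∘ ψ, hφ.comp hψ, g, hg⟩
  · obtain ⟨U, hU, hx, hn⟩ := (h ▸ mem_univ x : x ∈ fatouSet R)
    obtain ⟨K, hK, hKU, hKc⟩ := local_compact_nhds (hU.mem_nhds hx)
    refine ⟨K, mem_nhdsWithin_of_mem_nhds hK, fun s => ?_⟩
    obtain ⟨φ, hφ, g, hg⟩ := hn s
    exact ⟨φ, hφ, g, hg.tendstoUniformlyOn hKc hKU⟩

/-- Were the iterates normal on the whole sphere, a limit `g` of `R^[φ n]` would be onto, and a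
limit `k` of the gap iterates would satisfy `k ∘ g = g`. So `k` is the identity, and `R` would be
injective, contrary to `d ≥ 2`. -/
lemma juliaSet_nonempty (hR : 2 ≤ ratDegree R) : (juliaSet R).Nonempty := by
  rw [juliaSet, nonempty_compl]
  intro hF
  have hc : ∀ n, Continuous (ratMap R)^[n] := fun n => (continuous_ratMap R).iterate n
  have hs : ∀ n, Function.Surjective (ratMap R)^[n] := fun n =>
    (surjective_ratMap R (by lia)).iterate n
  obtain ⟨φ, hφ, g, hg⟩ := exists_tendstoUniformly_of_fatouSet_eq_univ R hF _root_.id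
  obtain ⟨ψ, hψ, k, hk⟩ := exists_tendstoUniformly_of_fatouSet_eq_univ R hF
    fun n => φ (n + 1) - φ n
  have hgc : Continuous g := hg.continuous (.of_forall fun n => hc _)
  have hkc : Continuous k := hk.continuous (.of_forall fun n => hc _)
  have hgs : Function.Surjective g := by
    intro w
    choose z hz using fun n => hs (φ n) w
    obtain ⟨a, θ, hθ, ha⟩ := CompactSpace.tendsto_subseq z
    refine ⟨a, ?_⟩
    have h1 : TendstoUniformly (fun n => (ratMap R)^[φ (θ n)]) g atTop := fun u hu =>
      hθ.tendsto_atTop.eventually (hg u hu)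
    refine tendsto_nhds_unique (h1.tendsto_comp hgc.continuousAt ha) ?_
    simp [hz]
  have hkg : ∀ x, k (g x) = g x := by
    intro x
    have h1 : Tendsto (fun n => (ratMap R)^[φ (ψ n)] x) atTop (𝓝 (g x)) :=
      (hg.tendsto_at x).comp hψ.tendsto_atTop
    have h2 : Tendsto (fun n => (ratMap R)^[φ (ψ n + 1)] x) atTop (𝓝 (g x)) :=
      (hg.tendsto_at x).comp ((tendsto_add_atTop_nat 1).comp hψ.tendsto_atTop)
    refine tendsto_nhds_unique (hk.tendsto_comp hkc.continuousAt h1) ?_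
    convert h2 using 2 with n
    rw [← Function.iterate_add_apply, Nat.sub_add_cancel (hφ (Nat.lt_succ_self _)).le]
  have hid : ∀ y, k y = y := fun y => by
    obtain ⟨x, rfl⟩ := hgs y
    exact hkg x
  refine not_injective_ratMap R hR fun a b hab => ?_
  rw [← hid a, ← hid b]
  refine tendsto_nhds_unique (hk.tendsto_at a) ((hk.tendsto_at b).congr fun n => ?_)
  -- The gaps are positive, so `R` is applied at least once and identifies the two orbits.
  obtain ⟨j, hj⟩ : ∃ j, φ (ψ n + 1) - φ (ψ n) = j + 1 :=
    Nat.exists_eq_succ_of_ne_zero (Nat.sub_pos_of_lt (hφ (Nat.lt_succ_self _))).ne'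
  rw [hj, Function.iterate_succ_apply, Function.iterate_succ_apply, hab]

end RationalDynamics

end

/-! ### Connected components and a map permuting them -/

noncomputable section

namespace RationalDynamics

open Set Filter Topology
open scoped OnePoint

section Components

variable {X : Type*} [TopologicalSpace X] {C D S A : Set X}

lemma IsComponentOf.isConnected (h : IsComponentOf C S) : IsConnected C := by
  obtain ⟨x, hx, rfl⟩ := h
  exact ⟨⟨x, mem_connectedComponentIn hx⟩, isPreconnected_connectedComponentIn⟩

lemma IsComponentOf.subset (h : IsComponentOf C S) : C ⊆ S := by
  obtain ⟨x, hx, rfl⟩ := h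
  exact connectedComponentIn_subset S x

lemma IsComponentOf.eq_connectedComponentIn (h : IsComponentOf C S) {x : X} (hx : x ∈ C) :
    C = connectedComponentIn S x := by
  obtain ⟨y, hy, rfl⟩ := h
  exact connectedComponentIn_eq hx

lemma IsComponentOf.subset_of_mem (h : IsComponentOf C S) (hA : IsPreconnected A) (hAS : A ⊆ S)
    {x : X} (hxA : x ∈ A) (hxC : x ∈ C) : A ⊆ C := by
  rw [h.eq_connectedComponentIn hxC]
  exact hA.subset_connectedComponentIn hxA hAS

lemma IsComponentOf.eq_of_mem (hC : IsComponentOf C S) (hD : IsComponentOf D S) {x : X}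
    (hxC : x ∈ C) (hxD : x ∈ D) : C = D :=
  (hC.eq_connectedComponentIn hxC).trans (hD.eq_connectedComponentIn hxD).symm

lemma isComponentOf_connectedComponentIn {x : X} (hx : x ∈ S) :
    IsComponentOf (connectedComponentIn S x) S := ⟨x, hx, rfl⟩

lemma IsComponentOf.isOpen [LocallyConnectedSpace X] (h : IsComponentOf C S) (hS : IsOpen S) :
    IsOpen C := by
  obtain ⟨x, hx, rfl⟩ := h
  exact hS.connectedComponentIn

lemma IsComponentOf.isClosed (h : IsComponentOf C S) (hS : IsClosed S) : IsClosed C := by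
  obtain ⟨x, hx⟩ := h.isConnected.nonempty
  exact isClosed_of_closure_subset <| h.subset_of_mem h.isConnected.isPreconnected.closure
    (closure_minimal h.subset hS) (subset_closure hx) hx

/-- A frontier point in `S` would lie in an open component meeting `C`, that is, in `C` itself,
which is open. -/
lemma IsComponentOf.frontier_subset_compl [LocallyConnectedSpace X] (h : IsComponentOf C S)
    (hS : IsOpen S) : frontier C ⊆ Sᶜ := by
  intro x hx hxS
  have hD := isComponentOf_connectedComponentIn hxS
  have hxD := mem_connectedComponentIn hxS
  obtain ⟨y, hyD, hyC⟩ := mem_closure_iff.1 hx.1 _ (hD.isOpen hS) hxD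
  rw [← h.eq_of_mem hD hyC hyD] at hxD
  exact hx.2 ((h.isOpen hS).interior_eq.symm ▸ hxD)

lemma isPreconnected_union_of_closure_inter {B : Set X} (hA : IsPreconnected A)
    (hB : IsPreconnected B) (h : (closure A ∩ B).Nonempty) : IsPreconnected (A ∪ B) := by
  obtain ⟨y, hyA, hyB⟩ := h
  have h1 : IsPreconnected (insert y A) :=
    hA.subset_closure (subset_insert _ _) (insert_subset hyA subset_closure)
  have h2 := h1.union y (mem_insert _ _) hyB hB
  rwa [insert_union, ← union_insert, insert_eq_of_mem hyB] at h2

lemma isPreconnected_union_sUnion {𝒟 : Set (Set X)} (hA : IsPreconnected A) (hne : A.Nonempty)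
    (h : ∀ D ∈ 𝒟, IsPreconnected (A ∪ D)) : IsPreconnected (A ∪ ⋃₀ 𝒟) := by
  obtain ⟨x, hx⟩ := hne
  refine isPreconnected_of_forall x ?_
  rintro y (hy | ⟨D, hD, hy⟩)
  · exact ⟨A, subset_union_left, hx, hy, hA⟩
  · exact ⟨A ∪ D, union_subset_union_right _ (subset_sUnion_of_mem hD), .inl hx, .inr hy, h D hD⟩

lemma IsComponentOf.frontier_nonempty [PreconnectedSpace X] (h : IsComponentOf C S)
    (hS : Sᶜ.Nonempty) : (frontier C).Nonempty := by
  refine nonempty_frontier_iff.2 ⟨h.isConnected.nonempty, fun hu => ?_⟩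
  obtain ⟨x, hx⟩ := hS
  exact hx (h.subset (hu ▸ mem_univ x))

/-- A connected set containing the complement of an open set stays connected after adding
components of the open set. -/
lemma isPreconnected_union_sUnion_components [PreconnectedSpace X] [LocallyConnectedSpace X]
    (hS : IsOpen S) (hne : Sᶜ.Nonempty) (hA : IsPreconnected A) (hSA : Sᶜ ⊆ A)
    {𝒟 : Set (Set X)} (h𝒟 : ∀ D ∈ 𝒟, IsComponentOf D S) : IsPreconnected (A ∪ ⋃₀ 𝒟) := by
  refine isPreconnected_union_sUnion hA (hne.mono hSA) fun D hD => ?_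
  obtain ⟨y, hy⟩ := (h𝒟 D hD).frontier_nonempty hne
  rw [union_comm]
  exact isPreconnected_union_of_closure_inter (h𝒟 D hD).isConnected.isPreconnected hA
    ⟨y, hy.1, hSA ((h𝒟 D hD).frontier_subset_compl hS hy)⟩

/-- The complement of a component of an open set, in terms of a set containing the complement of
the open set and of the other components. -/
lemma IsComponentOf.compl_eq (h : IsComponentOf C S) (hSA : Sᶜ ⊆ A) (hAC : Disjoint A C) :
    Cᶜ = A ∪ ⋃₀ {D | IsComponentOf D S ∧ D ≠ C} := by
  ext x
  constructor
  · intro hx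
    by_cases hxS : x ∈ S
    · refine .inr ⟨_, ⟨isComponentOf_connectedComponentIn hxS, ?_⟩, mem_connectedComponentIn hxS⟩
      rintro rfl
      exact hx (mem_connectedComponentIn hxS)
    · exact .inl (hSA hxS)
  · rintro (hx | ⟨D, ⟨hD, hDC⟩, hx⟩) hxC
    · exact hAC.le_bot ⟨hx, hxC⟩
    · exact hDC (hD.eq_of_mem h hx hxC)

/-- A map preserving a set with finitely many components permutes these if it is surjective,
so that a power of it fixes each of them. -/
lemma exists_iterate_mem_iff_of_finite_components {T : X → X} (hT : Continuous T)
    (hsurj : Function.Surjective T) (hTS : T ⁻¹' S = S)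
    (hfin : {C : Set X | IsComponentOf C S}.Finite) :
    (∀ C, IsComponentOf C S → ∀ x y, T x = T y → y ∈ C → x ∈ C) ∧
    ∃ m : ℕ, 0 < m ∧ ∀ C, IsComponentOf C S → ∀ (n : ℕ) x, T^[m * n] x ∈ C ↔ x ∈ C := by
  let 𝒞 := {C : Set X | IsComponentOf C S}
  have : Finite 𝒞 := hfin
  have hmem : ∀ x, T x ∈ S ↔ x ∈ S := fun x => by rw [← mem_preimage, hTS]
  have hτ : ∀ C : 𝒞, ∃ D : 𝒞, MapsTo T C D := by
    rintro ⟨C, hC⟩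
    obtain ⟨x, hx⟩ := hC.isConnected.nonempty
    have hTx := (hmem x).2 (hC.subset hx)
    refine ⟨⟨_, isComponentOf_connectedComponentIn hTx⟩, mapsTo_iff_image_subset.2 ?_⟩
    refine (isComponentOf_connectedComponentIn hTx).subset_of_mem
      (hC.isConnected.isPreconnected.image _ hT.continuousOn) ?_ (mem_image_of_mem T hx)
      (mem_connectedComponentIn hTx)
    rintro _ ⟨y, hy, rfl⟩
    exact (hmem y).2 (hC.subset hy)
  choose τ hτ using hτ
  have hτs : Function.Surjective τ := by
    rintro ⟨D, hD⟩
    obtain ⟨y, hy⟩ := hD.isConnected.nonempty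
    obtain ⟨x, rfl⟩ := hsurj y
    have hxS := (hmem x).1 (hD.subset hy)
    refine ⟨⟨_, isComponentOf_connectedComponentIn hxS⟩, Subtype.ext ?_⟩
    exact IsComponentOf.eq_of_mem (τ _).2 hD (hτ _ (mem_connectedComponentIn hxS)) hy
  have hτi : Function.Injective τ := Finite.injective_iff_surjective.2 hτs
  have hiff : ∀ (C : 𝒞) x, T x ∈ (τ C : Set X) ↔ x ∈ (C : Set X) := by
    refine fun C x => ⟨fun hx => ?_, fun hx => hτ C hx⟩
    have hxS := (hmem x).1 (IsComponentOf.subset (τ C).2 hx)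
    have h1 : τ ⟨_, isComponentOf_connectedComponentIn hxS⟩ = τ C := Subtype.ext <|
      IsComponentOf.eq_of_mem (τ _).2 (τ C).2 (hτ _ (mem_connectedComponentIn hxS)) hx
    rw [← hτi h1]
    exact mem_connectedComponentIn hxS
  have hiter : ∀ (n : ℕ) (C : 𝒞) x, T^[n] x ∈ (τ^[n] C : Set X) ↔ x ∈ (C : Set X) := by
    intro n
    induction n with
    | zero => exact fun _ _ => Iff.rfl
    | succ n ih =>
      intro C x
      rw [Function.iterate_succ_apply, Function.iterate_succ_apply, ih, hiff]
  refine ⟨fun C hC x y hxy hy => ?_, ?_⟩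
  · rw [← hiff ⟨C, hC⟩, hxy, hiff]
    exact hy
  · let e : Equiv.Perm 𝒞 := Equiv.ofBijective τ ⟨hτi, hτs⟩
    refine ⟨orderOf e, orderOf_pos e, fun C hC n x => ?_⟩
    have h1 : τ^[orderOf e * n] = id := by
      have h2 : ⇑(e ^ (orderOf e * n)) = τ^[orderOf e * n] := by
        rw [Equiv.Perm.coe_pow]
        rfl
      rw [← h2, pow_mul, pow_orderOf_eq_one, one_pow, Equiv.Perm.coe_one]
    have h2 := hiter (orderOf e * n) ⟨C, hC⟩ x
    rwa [h1] at h2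

end Components

/-! ### Completely invariant Fatou components -/

variable {R : RatFunc ℂ} {F₀ : Set (OnePoint ℂ)}

lemma IsCompletelyInvariant.iterate_mem_iff {X : Type*} {T : X → X} {E : Set X}
    (h : IsCompletelyInvariant T E) (n : ℕ) (x : X) : T^[n] x ∈ E ↔ x ∈ E := by
  induction n generalizing x with
  | zero => rfl
  | succ n ih => rw [Function.iterate_succ_apply, ih, ← mem_preimage, h.2]

/-- Outside `closure F₀` no orbit ever enters `F₀`, so the iterates omit an open set there and are
normal. -/
lemma frontier_eq_juliaSet (hF₀ : IsComponentOf F₀ (fatouSet R))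
    (hinv : IsCompletelyInvariant (ratMap R) F₀) : frontier F₀ = juliaSet R := by
  have ho : IsOpen F₀ := hF₀.isOpen (isOpen_fatouSet R)
  refine (hF₀.frontier_subset_compl (isOpen_fatouSet R)).antisymm fun x hx => ?_
  rw [ho.frontier_eq]
  refine ⟨by_contra fun hxc => hx ?_, fun h => hx (hF₀.subset h)⟩
  obtain ⟨q, hq⟩ := hF₀.isConnected.nonempty
  refine mem_fatouSet_of_notMem_nhds R isClosed_closure.isOpen_compl hxc (ho.mem_nhds hq)
    fun n s hs hsn => hs (subset_closure ((hinv.iterate_mem_iff n s).1 hsn))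

lemma compl_nonempty_of_isComponentOf (hR : 2 ≤ ratDegree R) (hF₀ : IsComponentOf F₀ (fatouSet R)) :
    F₀ᶜ.Nonempty :=
  (juliaSet_nonempty R hR).mono (compl_subset_compl.2 hF₀.subset)

lemma isSimplyConnected_of_ne (hR : 2 ≤ ratDegree R) (hF₀ : IsComponentOf F₀ (fatouSet R))
    (hinv : IsCompletelyInvariant (ratMap R) F₀) {F₁ : Set (OnePoint ℂ)}
    (hF₁ : IsComponentOf F₁ (fatouSet R)) (hne : F₁ ≠ F₀) : IsSimplyConnected F₁ := by
  have ho := hF₁.isOpen (isOpen_fatouSet R)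
  have hJ : (fatouSet R)ᶜ ⊆ closure F₀ := by
    rw [← juliaSet, ← frontier_eq_juliaSet hF₀ hinv]
    exact frontier_subset_closure
  have hd : Disjoint F₀ F₁ := disjoint_left.2 fun x h0 h1 => hne (hF₁.eq_of_mem hF₀ h1 h0)
  refine isSimplyConnected_of_isConnected_compl ho hF₁.isConnected
    ⟨compl_nonempty_of_isComponentOf hR hF₁, ?_⟩
  rw [hF₁.compl_eq hJ (hd.closure_left ho)]
  exact isPreconnected_union_sUnion_components (isOpen_fatouSet R) (juliaSet_nonempty R hR)
    hF₀.isConnected.isPreconnected.closure hJ fun D hD => hD.1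

/-- Forward, `J` is the intersection of `closure F₀` and `F₀ᶜ`, two connected closed sets covering
the sphere. Backward, `F₀ᶜ` is `J` with the other Fatou components attached. -/
lemma isSimplyConnected_iff_isConnected_juliaSet (hR : 2 ≤ ratDegree R)
    (hF₀ : IsComponentOf F₀ (fatouSet R)) (hinv : IsCompletelyInvariant (ratMap R) F₀) :
    IsSimplyConnected F₀ ↔ IsConnected (juliaSet R) := by
  have ho := hF₀.isOpen (isOpen_fatouSet R)
  refine ⟨fun h => ⟨juliaSet_nonempty R hR, ?_⟩, fun h => ?_⟩
  · rw [← frontier_eq_juliaSet hF₀ hinv, ho.frontier_eq, sdiff_eq]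
    refine isPreconnected_inter_of_union_eq_univ isClosed_closure ho.isClosed_compl
      hF₀.isConnected.isPreconnected.closure (IsSimplyConnected.isPreconnected_compl ho h) ?_
    exact univ_subset_iff.1 ((union_compl_self F₀).symm.subset.trans
      (union_subset_union_left _ subset_closure))
  · refine isSimplyConnected_of_isConnected_compl ho hF₀.isConnected
      ⟨compl_nonempty_of_isComponentOf hR hF₀, ?_⟩
    rw [hF₀.compl_eq (A := juliaSet R) subset_rfl
      (disjoint_left.2 fun x hx hx0 => hx (hF₀.subset hx0))]
    exact isPreconnected_union_sUnion_components (isOpen_fatouSet R) (juliaSet_nonempty R hR)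
      h.isPreconnected subset_rfl fun D hD => hD.1

/-- Every component of the complement of `F₀` meets the Julia set. -/
lemma inter_juliaSet_nonempty (hR : 2 ≤ ratDegree R)
    (hF₀ : IsComponentOf F₀ (fatouSet R)) {C : Set (OnePoint ℂ)} (hC : IsComponentOf C F₀ᶜ) :
    (C ∩ juliaSet R).Nonempty := by
  by_contra hCJ
  have hCF : C ⊆ fatouSet R := fun x hx => by_contra fun hxF => hCJ ⟨x, hx, hxF⟩
  obtain ⟨x, hx⟩ := hC.isConnected.nonempty
  have hD := isComponentOf_connectedComponentIn (hCF hx)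
  have hxD := mem_connectedComponentIn (hCF hx)
  -- A Fatou component met by `C` lies inside `C`; its nonempty frontier is in `J`, and in `C`
  -- because `C` is closed.
  have hDC : connectedComponentIn (fatouSet R) x ⊆ C :=
    hC.subset_of_mem hD.isConnected.isPreconnected (fun y hyD hy0 =>
      hC.subset hx (hD.eq_of_mem hF₀ hyD hy0 ▸ hxD)) hxD hx
  obtain ⟨y, hy⟩ := hD.frontier_nonempty (juliaSet_nonempty R hR)
  have hcl := hC.isClosed (hF₀.isOpen (isOpen_fatouSet R)).isClosed_compl
  exact hCJ ⟨y, closure_minimal hDC hcl hy.1, hD.frontier_subset_compl (isOpen_fatouSet R) hy⟩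

/-- A finite set of points with `R⁻¹(R p) = {p}`, whose complement is completely invariant, lies in
the Fatou set. -/
lemma mem_fatouSet_of_finite (hR : 2 ≤ ratDegree R) (ho : IsOpen F₀) (hne : F₀.Nonempty)
    (hinv : IsCompletelyInvariant (ratMap R) F₀) (hfin : F₀ᶜ.Finite)
    (hex : ∀ p ∈ F₀ᶜ, ratMap R ⁻¹' {ratMap R p} = {p}) {p : OnePoint ℂ} (hp : p ∈ F₀ᶜ) :
    p ∈ fatouSet R := by
  have h1 : ∀ p ∈ F₀ᶜ, ∀ᶠ ρ in 𝓝[>] (0 : ℝ), ∀ s, dist s p < ρ →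
      dist (ratMap R s) (ratMap R p) ≤ dist s p := by
    intro p hp
    obtain ⟨ρ, hρ, h⟩ := exists_dist_ratMap_le R hR (hex p hp)
    filter_upwards [Ioo_mem_nhdsGT hρ] with r hr s hs
    exact h s (hs.trans hr.2)
  obtain ⟨ρ, hρ, hρ0⟩ := (((eventually_all_finite hfin).2 h1).and self_mem_nhdsWithin).exists
  obtain ⟨q, hq⟩ := hne
  obtain ⟨η, hη, hball⟩ := Metric.isOpen_iff.1 ho q hq
  -- The orbit of `p` stays in the finite set `F₀ᶜ`, on which `ρ` is uniform, so the estimate can be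
  -- iterated.
  have h2 : ∀ (n : ℕ) s, dist s p < ρ →
      dist ((ratMap R)^[n] s) ((ratMap R)^[n] p) ≤ dist s p := by
    intro n s hs
    induction n with
    | zero => rfl
    | succ n ih =>
      rw [Function.iterate_succ_apply', Function.iterate_succ_apply']
      exact (hρ _ (fun h => hp ((hinv.iterate_mem_iff n p).1 h)) _ (ih.trans_lt hs)).trans ih
  -- An iterate of `s` within `η / 2` of `q` would put the same iterate of `p` within `η` of `q`,
  -- hence in `F₀`.
  refine mem_fatouSet_of_notMem_nhds R (V := Metric.ball p (min ρ (η / 2)))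
    (W := Metric.ball q (η / 2)) Metric.isOpen_ball
    (Metric.mem_ball_self (lt_min hρ0 (half_pos hη))) (Metric.ball_mem_nhds q (half_pos hη)) ?_
  intro n s hs hsn
  rw [Metric.mem_ball, lt_min_iff] at hs
  refine hp ((hinv.iterate_mem_iff n p).1 (hball ?_))
  rw [Metric.mem_ball] at hsn ⊢
  have h3 := h2 n s hs.1
  have h4 := dist_triangle_left ((ratMap R)^[n] p) q ((ratMap R)^[n] s)
  linarith [hs.2]

lemma isPreconnected_compl_of_finite_components (hR : 2 ≤ ratDegree R)
    (hF₀ : IsComponentOf F₀ (fatouSet R)) (hinv : IsCompletelyInvariant (ratMap R) F₀)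
    (hfin : {C : Set (OnePoint ℂ) | IsComponentOf C F₀ᶜ}.Finite) : IsPreconnected F₀ᶜ := by
  have ho := hF₀.isOpen (isOpen_fatouSet R)
  have hmeet := fun {C} (hC : IsComponentOf C F₀ᶜ) =>
    inter_juliaSet_nonempty hR hF₀ hC
  have hsurj := surjective_ratMap R (by lia)
  have hpre : ratMap R ⁻¹' F₀ᶜ = F₀ᶜ := by rw [preimage_compl, hinv.2]
  obtain ⟨hinj, m, hm, hiter⟩ := exists_iterate_mem_iff_of_finite_components
    (continuous_ratMap R) hsurj hpre hfin
  by_contra hcon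
  have hother : ∀ C, IsComponentOf C F₀ᶜ → ∃ D, IsComponentOf D F₀ᶜ ∧ D ≠ C := by
    intro C hC
    by_contra! hall
    refine hcon ?_
    convert hC.isConnected.isPreconnected
    refine Subset.antisymm (fun x hx => ?_) hC.subset
    rw [← hall _ (isComponentOf_connectedComponentIn hx)]
    exact mem_connectedComponentIn hx
  -- If all components are points, injectivity on components means total ramification at each of
  -- them.
  by_cases hsub : ∀ C, IsComponentOf C F₀ᶜ → C.Subsingleton
  · have hEfin : F₀ᶜ.Finite := by
      refine (hfin.sUnion fun C hC => (hsub C hC).finite).subset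
        fun x hx => ⟨_, isComponentOf_connectedComponentIn hx, mem_connectedComponentIn hx⟩
    have hex : ∀ p ∈ F₀ᶜ, ratMap R ⁻¹' {ratMap R p} = {p} := by
      refine fun p hp => eq_singleton_iff_unique_mem.2 ⟨rfl, fun x hx => ?_⟩
      have hC := isComponentOf_connectedComponentIn hp
      exact hsub _ hC (hinj _ hC x p hx (mem_connectedComponentIn hp))
        (mem_connectedComponentIn hp)
    obtain ⟨p, hp⟩ := juliaSet_nonempty R hR
    exact hp (mem_fatouSet_of_finite hR ho hF₀.isConnected.nonempty hinv hEfin hex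
      fun h => hp (hF₀.subset h))
  · push Not at hsub
    obtain ⟨C, hC, p, hp, q, hq, hpq⟩ := hsub
    obtain ⟨D, hD, hDC⟩ := hother C hC
    obtain ⟨x, hxD, hxJ⟩ := hmeet hD
    have hUo : IsOpen Cᶜ := (hC.isClosed ho.isClosed_compl).isOpen_compl
    have hU : Cᶜ = F₀ ∪ ⋃₀ {D | IsComponentOf D F₀ᶜ ∧ D ≠ C} :=
      hC.compl_eq (by rw [compl_compl]) (disjoint_left.2 fun y hy0 hyC => hC.subset hyC hy0)
    -- Each of the other components contains a Julia point, which is a limit of points of `F₀`.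
    have hUc : IsConnected Cᶜ := by
      refine ⟨⟨x, fun hxC => hDC (hD.eq_of_mem hC hxD hxC)⟩, ?_⟩
      rw [hU]
      refine isPreconnected_union_sUnion hF₀.isConnected.isPreconnected
        hF₀.isConnected.nonempty fun D' hD' => ?_
      obtain ⟨y, hyD, hyJ⟩ := hmeet hD'.1
      rw [← frontier_eq_juliaSet hF₀ hinv] at hyJ
      exact isPreconnected_union_of_closure_inter hF₀.isConnected.isPreconnected
        hD'.1.isConnected.isPreconnected ⟨y, hyJ.1, hyD⟩
    have hxU : x ∈ Cᶜ := fun hxC => hDC (hD.eq_of_mem hC hxD hxC)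
    -- The iterates of `R^[m]` preserve `Cᶜ`, which omits two points and has connected complement,
    -- so they are equicontinuous at the Julia point `x`.
    refine hxJ (mem_fatouSet_of_iterate_mul R hm ?_)
    filter_upwards [hUo.mem_nhds hxU] with y hy
    exact equicontinuousAt_of_mapsTo (fun n => (hasLift_ratMap R).iterate (m * n)) hUo hUc
      (by rw [compl_compl]; exact hC.isConnected.isPreconnected) (not_not.2 hp) (not_not.2 hq) hpq
      (fun n s hs hsC => hs ((hiter C hC n s).1 hsC)) hy

end RationalDynamics

end

theorem theorem1p6p5 (R : RatFunc ℂ) (hR : 2 ≤ RationalDynamics.ratDegree R)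
    (F₀ : Set (OnePoint ℂ))
    (hF₀ : RationalDynamics.IsComponentOf F₀ (RationalDynamics.fatouSet R))
    (hinv : RationalDynamics.IsCompletelyInvariant (RationalDynamics.ratMap R) F₀) :
    frontier F₀ = RationalDynamics.juliaSet R ∧
    (IsSimplyConnected F₀ ∨ RationalDynamics.IsInfinitelyConnected F₀) ∧
    (∀ F₁ : Set (OnePoint ℂ),
      RationalDynamics.IsComponentOf F₁ (RationalDynamics.fatouSet R) → F₁ ≠ F₀ →
        IsSimplyConnected F₁) ∧
    (IsSimplyConnected F₀ ↔ IsConnected (RationalDynamics.juliaSet R)) := by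
  refine ⟨RationalDynamics.frontier_eq_juliaSet hF₀ hinv, ?_,
    fun F₁ hF₁ hne => RationalDynamics.isSimplyConnected_of_ne hR hF₀ hinv hF₁ hne,
    RationalDynamics.isSimplyConnected_iff_isConnected_juliaSet hR hF₀ hinv⟩
  refine or_iff_not_imp_right.2 fun hfin => ?_
  exact RationalDynamics.isSimplyConnected_of_isConnected_compl
    (hF₀.isOpen (RationalDynamics.isOpen_fatouSet R)) hF₀.isConnected
    ⟨RationalDynamics.compl_nonempty_of_isComponentOf hR hF₀,
      RationalDynamics.isPreconnected_compl_of_finite_components hR hF₀ hinv (Set.not_infinite.1 hfin)⟩
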